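/- **Theorem 1.4.** Let $\mu$ be a finite positive Borel measure (not necessarily normalized) on the unit circle $\partial\mathbb{D}$, with Lebesgue decomposition $$d\mu(e^{i\theta}) = w(\theta)\,\frac{d\theta}{2\pi} + d\mu_{\mathrm{s}}(e^{i\theta}),$$ where $\mu_{\mathrm{s}}$ is singular with respect to $d\theta$. Let $\Phi_n$ be the monic orthogonal polynomials of $\mu$, $\varphi_n=\Phi_n/\|\Phi_n\|_{L^2(d\mu)}$ the orthonormal polynomials, $\alpha_n$ $(n\ge 0)$ the Verblunsky coefficients, determined by $$\Phi_{n+1}(z)=z\Phi_n(z)-\bar\alpha_n\Phi_n^*(z),\qquad \Phi_n^*(z)=z^n\,\overline{\Phi_n(1/\bar z)},$$ that is, $\alpha_n=-\overline{\Phi_{n+1}(0)}$; let $\rho_n=(1-|\alpha_n|^2)^{1/2}$, and let $$K_n(z,\zeta)=\sum_{j=0}^n\overline{\varphi_j(z)}\,\varphi_j(\zeta)$$ be the Christoffel–Darboux kernel. Let $I$ be an interval on $\partial\mathbb{D}$, that is, $I=\{e^{i\theta}:\theta\in J\}$ for an interval $J\subset\mathbb{R}$ (open, closed or half-open) with more than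 one point. Suppose that (a) $w(\theta)>0$ for a.e. $e^{i\theta}\in I$, and (b) $\mu$ is regular for $\partial\mathbb{D}$, that is, $(\rho_1\cdots\rho_n)^{1/n}\to 1$ as $n\to\infty$. Then, as $n\to\infty$, (i) $\displaystyle\int_I \frac{1}{n+1}\,K_n(e^{i\theta},e^{i\theta})\,d\mu_{\mathrm{s}}(\theta)\to 0$, and (ii) $\displaystyle\int_I\Bigl|1-w(\theta)\,\frac{1}{n+1}\,K_n(e^{i\theta},e^{i\theta})\Bigr|\,\frac{d\theta}{2\pi}\to 0$. (By (a), $\mu$ has infinite support, so all the $\varphi_n$ are defined.) -/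

import Mathlib

open MeasureTheory Filter Topology Polynomial
open scoped ComplexConjugate

noncomputable section

namespace OPUC

/-- The unit circle carries its Borel σ-algebra. -/
instance : MeasurableSpace Circle := borel Circle

instance : BorelSpace Circle := ⟨rfl⟩

/-- The normalized Lebesgue measure `dθ / 2π` on the unit circle: the image of the normalized
Lebesgue measure on `(-π, π]` under `θ ↦ e^{iθ}`. -/
def arcMeasure : Measure Circle :=
  ((ENNReal.ofReal (2 * Real.pi))⁻¹ •
    (volume.restrict (Set.Ioc (-Real.pi) Real.pi) : Measure ℝ)).map Circle.exp

/-- The density `w` in the Lebesgue decomposition `dμ = w dθ/2π + dμ_s`. -/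
def weight (μ : Measure Circle) (z : Circle) : ℝ := (μ.rnDeriv arcMeasure z).toReal

/-- The singular part `μ_s` in the Lebesgue decomposition `dμ = w dθ/2π + dμ_s`. -/
def singPart (μ : Measure Circle) : Measure Circle := μ.singularPart arcMeasure

/-- The inner product `⟨P, Q⟩ = ∫ conj (P(z)) Q(z) dμ(z)` of two polynomials in `L²(∂𝔻, dμ)`. -/
def polyInner (μ : Measure Circle) (P Q : ℂ[X]) : ℂ :=
  ∫ z : Circle, conj (P.eval (z : ℂ)) * Q.eval (z : ℂ) ∂μ

/-- The norm `‖P‖ = (∫ |P|² dμ)^{1/2}` of a polynomial in `L²(∂𝔻, dμ)`. -/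
def polyNorm (μ : Measure Circle) (P : ℂ[X]) : ℝ :=
  Real.sqrt (∫ z : Circle, ‖P.eval (z : ℂ)‖ ^ 2 ∂μ)

/-- The monic orthogonal polynomials `Φ_n(z, dμ)`, obtained from `1, z, z², …` by the Gram–Schmidt
process (without normalization) in `L²(∂𝔻, dμ)`. -/
def monicOP (μ : Measure Circle) : ℕ → ℂ[X]
  | n => X ^ n - ∑ k : Fin n,
      C (polyInner μ (monicOP μ k) (X ^ n) / polyInner μ (monicOP μ k) (monicOP μ k)) *
        monicOP μ k
termination_by n => n
decreasing_by all_goals exact k.isLt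

/-- The orthonormal polynomials `φ_n = Φ_n / ‖Φ_n‖`. -/
def normOP (μ : Measure Circle) (n : ℕ) : ℂ[X] :=
  C ((polyNorm μ (monicOP μ n) : ℂ)⁻¹) * monicOP μ n

/-- The Christoffel–Darboux kernel `K_n(z, w) = ∑_{j=0}^n conj (φ_j(z)) φ_j(w)`. -/
def cdKernel (μ : Measure Circle) (n : ℕ) (z w : ℂ) : ℂ :=
  ∑ j ∈ Finset.range (n + 1), conj ((normOP μ j).eval z) * (normOP μ j).eval w

/-- The Verblunsky coefficients `α_n = -conj (Φ_{n+1}(0))`. Since `Φ_n^*(0) = 1`, this is the value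
at `z = 0` of the recursion `Φ_{n+1}(z) = z Φ_n(z) - conj α_n Φ_n^*(z)` that determines `α_n`. -/
def verblunsky (μ : Measure Circle) (n : ℕ) : ℂ := -conj ((monicOP μ (n + 1)).eval 0)

/-- `ρ_n = (1 - |α_n|²)^{1/2}`. -/
def rho (μ : Measure Circle) (n : ℕ) : ℝ := Real.sqrt (1 - ‖verblunsky μ n‖ ^ 2)

/-- Regularity of `μ` for the unit circle: `(ρ_1 ⋯ ρ_n)^{1/n} → 1`. -/
def IsRegularCircle (μ : Measure Circle) : Prop :=
  Tendsto (fun n : ℕ => (∏ j ∈ Finset.Icc 1 n, rho μ j) ^ (1 / (n : ℝ))) atTop (𝓝 1)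

/-- `I` is an arc (interval) of the unit circle: the set of all `e^{iθ}` with `θ` in some interval
of `ℝ` (open, closed or half-open) that has more than one point. The whole circle is allowed. -/
def IsArc (I : Set Circle) : Prop :=
  ∃ J : Set ℝ, J.OrdConnected ∧ J.Nontrivial ∧ I = Circle.exp '' J

end OPUC

end

noncomputable section

namespace OPUC

/-! Write k_n = K_n(z,z)/(n+1). Two facts about k_n combine.

Mass on arcs: the probability measures k_n dμ converge weakly to dθ/2π, so ∫_I k_n dμ → |I|. Indeed
z^k φ_j is close to φ_{j+k}, with error controlled by |α_j|, …, |α_{j+k-1}|, and φ_j ⟂ φ_{j+k}. The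
k-th moment of k_n dμ is therefore bounded by Cesàro means of |α_j|, which regularity sends to zero
(`IsNondegenerate.tendsto_cdMeasure`, `IsNondegenerate.tendsto_setIntegral_cdDensity`).

Lower bound (Máté–Nevai): the extremal property of K_n, tested on a geometric sum, gives 1 ≤ k_n(z)
· (Fejér mean of μ at z). The Fejér means of w converge to w in L¹, and those of μ_s are small off a
small set. As w > 0 a.e. on I, the positive part (1 - w k_n)_+ tends to 0 in L¹(I)
(`IsNondegenerate.tendsto_setIntegral_max_one_sub`).

Since |x| = 2x_+ - x, the sum of the quantities in (i) and (ii) equals ∫_I k_n dμ - |I| + 2∫_I (1 -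
w k_n)_+, which tends to 0. Both are nonnegative, so each tends to 0. -/

instance isProbabilityMeasure_arcMeasure : IsProbabilityMeasure arcMeasure := by
  unfold arcMeasure
  have : IsProbabilityMeasure ((ENNReal.ofReal (2 * Real.pi))⁻¹ •
      (volume.restrict (Set.Ioc (-Real.pi) Real.pi) : Measure ℝ)) := by
    constructor
    have h : Real.pi - -Real.pi = 2 * Real.pi := by ring
    simp only [Measure.smul_apply, Measure.restrict_apply MeasurableSet.univ, Set.univ_inter,
      Real.volume_Ioc, smul_eq_mul, h]
    exact ENNReal.inv_mul_cancel (by simpa using Real.pi_pos) ENNReal.ofReal_ne_top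
  exact Measure.isProbabilityMeasure_map (by fun_prop)

/-- `arcMeasure` as a term of `ProbabilityMeasure`. -/
def arcProbabilityMeasure : ProbabilityMeasure Circle := ⟨arcMeasure, inferInstance⟩

/-! ### Normalized Lebesgue measure on the circle -/

theorem arcMeasure_eq_zero_iff {s : Set Circle} (hs : MeasurableSet s) :
    arcMeasure s = 0 ↔ volume (Circle.exp ⁻¹' s ∩ Set.Ioc (-Real.pi) Real.pi) = 0 := by
  have hm : Measurable (Circle.exp : ℝ → Circle) := Circle.exp.continuous.measurable
  rw [arcMeasure, Measure.map_apply hm hs, Measure.smul_apply, Measure.restrict_apply (hm hs)]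
  simp [ENNReal.mul_eq_top]

theorem integral_pow_arcMeasure {k : ℕ} (hk : k ≠ 0) :
    ∫ z : Circle, (z : ℂ) ^ k ∂arcMeasure = 0 := by
  have hm : Measurable (Circle.exp : ℝ → Circle) := Circle.exp.continuous.measurable
  rw [arcMeasure, integral_map hm.aemeasurable
    (by exact (Continuous.aestronglyMeasurable (by fun_prop))), integral_smul_measure]
  have h : ∫ x in Set.Ioc (-Real.pi) Real.pi, ((Circle.exp x : Circle) : ℂ) ^ k = 0 := by
    rw [← intervalIntegral.integral_of_le (by linarith [Real.pi_pos])]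
    have hc : (k : ℂ) * Complex.I ≠ 0 := by simp [hk]
    have := integral_exp_mul_complex (a := -Real.pi) (b := Real.pi) hc
    have h2 : ∀ x : ℝ, ((Circle.exp x : Circle) : ℂ) ^ k
        = Complex.exp ((k : ℂ) * Complex.I * x) := by
      intro x
      rw [Circle.coe_exp, ← Complex.exp_nat_mul]
      ring_nf
    simp only [h2]
    rw [this, div_eq_zero_iff]
    left
    rw [sub_eq_zero, Complex.exp_eq_exp_iff_exists_int]
    refine ⟨k, ?_⟩
    push_cast
    ring
  rw [h, smul_zero]

instance nullSingletonClass_arcMeasure : NullSingletonClass arcMeasure := by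
  constructor
  intro z
  rw [arcMeasure_eq_zero_iff (measurableSet_singleton z)]
  refine Set.Subsingleton.measure_zero ?_ _
  rintro x ⟨hx, hx'⟩ y ⟨hy, hy'⟩
  have hi := Circle.exp_injOn_Ioc (a := -Real.pi) (b := Real.pi) (by linarith)
  exact hi hx' hy' (by simp_all)

instance isOpenPosMeasure_arcMeasure : arcMeasure.IsOpenPosMeasure := by
  constructor
  intro U hU hne h0
  rw [arcMeasure_eq_zero_iff hU.measurableSet] at h0
  obtain ⟨z, hz⟩ := hne
  have hV : IsOpen (Circle.exp ⁻¹' U) := hU.preimage Circle.exp.continuous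
  -- The argument may equal the endpoint π, where `Ioc` is not a neighbourhood; passing to the
  -- closure of `Ioo` avoids this.
  have hzm : z.val.arg ∈ closure (Set.Ioo (-Real.pi) Real.pi) := by
    rw [closure_Ioo (by linarith [Real.pi_pos])]
    exact Set.Ioc_subset_Icc_self (Complex.arg_mem_Ioc _)
  have hne : (Circle.exp ⁻¹' U ∩ Set.Ioo (-Real.pi) Real.pi).Nonempty :=
    mem_closure_iff.1 hzm _ hV (by simpa using hz)
  exact (hV.inter isOpen_Ioo).measure_ne_zero volume hne
    (measure_mono_null (Set.inter_subset_inter_right _ Set.Ioo_subset_Ioc_self) h0)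

/-! ### Arcs -/

theorem countable_frontier_of_ordConnected {J : Set ℝ} (hJ : J.OrdConnected) :
    (frontier J).Countable := by
  have hsub : frontier J ⊆ {sInf J, sSup J} := by
    rintro x ⟨hx, hx'⟩
    have hne : J.Nonempty := closure_nonempty_iff.1 ⟨x, hx⟩
    by_cases hu : x ∈ upperBounds J
    · exact Or.inr ((isLUB_of_mem_closure hu hx).csSup_eq hne).symm
    by_cases hl : x ∈ lowerBounds J
    · exact Or.inl ((isGLB_of_mem_closure hl hx).csInf_eq hne).symm
    simp only [mem_upperBounds, mem_lowerBounds, not_forall, not_le] at hu hl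
    obtain ⟨y, hy, hxy⟩ := hu
    obtain ⟨z, hz, hzx⟩ := hl
    exact absurd (interior_maximal (Set.Ioo_subset_Icc_self.trans (hJ.out hz hy)) isOpen_Ioo
      ⟨hzx, hxy⟩) hx'
  exact (Set.toFinite _).countable.mono hsub

/-- For bounded `J` the image of its closure is compact and that of its interior is open, so
boundary points come from boundary points of `J`. An unbounded `J` covers a full period. -/
theorem IsArc.frontier_countable {I : Set Circle} (hI : IsArc I) : (frontier I).Countable := by
  obtain ⟨J, hJ, -, rfl⟩ := hI
  by_cases hb : Bornology.IsBounded J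
  · refine ((countable_frontier_of_ordConnected hJ).image Circle.exp).mono ?_
    have hc : IsClosed (Circle.exp '' closure J) :=
      (hb.isCompact_closure.image Circle.exp.continuous).isClosed
    have ho : IsOpen (Circle.exp '' interior J) :=
      isLocalHomeomorph_circleExp.isOpenMap _ isOpen_interior
    rintro z ⟨hz, hz'⟩
    obtain ⟨x, hx, rfl⟩ := closure_minimal (Set.image_mono subset_closure) hc hz
    exact ⟨x, ⟨hx, fun hi => hz' (interior_maximal (Set.image_mono interior_subset) ho
      ⟨x, hi, rfl⟩)⟩, rfl⟩
  · have : Circle.exp '' J = Set.univ := by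
      simp only [Metric.isBounded_iff, not_exists, not_forall, not_le] at hb
      obtain ⟨x, hx, y, hy, hxy⟩ := hb (2 * Real.pi)
      wlog hle : x ≤ y generalizing x y
      · exact this y hy x hx (by rwa [dist_comm]) (le_of_not_ge hle)
      rw [Real.dist_eq, abs_sub_comm, abs_of_nonneg (by linarith)] at hxy
      refine Set.eq_univ_of_forall fun z => ?_
      obtain ⟨t, ht, htz⟩ := Circle.periodic_exp.exists_mem_Ico (by positivity) z.val.arg x
      refine ⟨t, hJ.out hx hy ⟨ht.1, by linarith [ht.2]⟩, ?_⟩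
      rw [← htz, Circle.exp_arg]
    simp [this]

theorem IsArc.measurableSet {I : Set Circle} (hI : IsArc I) : MeasurableSet I := by
  have h : I = interior I ∪ (I ∩ frontier I) := by
    ext z
    constructor
    · intro hz
      by_cases hi : z ∈ interior I
      · exact Or.inl hi
      · exact Or.inr ⟨hz, subset_closure hz, hi⟩
    · rintro (hz | hz)
      · exact interior_subset hz
      · exact hz.1
  rw [h]
  exact isOpen_interior.measurableSet.union
    (hI.frontier_countable.mono Set.inter_subset_right).measurableSet

theorem IsArc.arcMeasure_ne_zero {I : Set Circle} (hI : IsArc I) : arcMeasure I ≠ 0 := by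
  obtain ⟨J, hJ, hJn, rfl⟩ := hI
  obtain ⟨x, hx, y, hy, hxy⟩ := hJn.exists_lt
  have ho : IsOpen (Circle.exp '' Set.Ioo x y) := isLocalHomeomorph_circleExp.isOpenMap _ isOpen_Ioo
  intro h
  refine ho.measure_ne_zero arcMeasure ((Set.nonempty_Ioo.2 hxy).image _) (measure_mono_null ?_ h)
  exact Set.image_mono (Set.Ioo_subset_Icc_self.trans (hJ.out hx hy))

/-! ### Weak convergence from trigonometric moments -/

/-- The character `z ↦ z ^ n` of the unit circle as a bounded continuous function. -/
def zpowBCF : Multiplicative ℤ →* BoundedContinuousFunction Circle ℂ where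
  toFun n := BoundedContinuousFunction.mkOfCompact
    ⟨fun z : Circle => ((z ^ (Multiplicative.toAdd n) : Circle) : ℂ),
      continuous_subtype_val.comp (continuous_zpow _)⟩
  map_one' := by ext; simp
  map_mul' m n := by ext; simp [zpow_add]

/-- The star algebra of trigonometric polynomials on the unit circle. -/
def trigSubalgebra : StarSubalgebra ℂ (BoundedContinuousFunction Circle ℂ) where
  toSubalgebra := Algebra.adjoin ℂ (Set.range zpowBCF)
  star_mem' := by
    change Algebra.adjoin ℂ (Set.range zpowBCF) ≤ star (Algebra.adjoin ℂ (Set.range zpowBCF))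
    refine Algebra.adjoin_le ?_
    rintro - ⟨n, rfl⟩
    refine Algebra.subset_adjoin ⟨n⁻¹, ?_⟩
    ext z
    simp [zpowBCF, ← Circle.coe_inv_eq_conj]

/-- The characters are closed under products, so the algebra they generate is their span;
convergence need only be tested on single characters. -/
theorem mem_trigSubalgebra {g : BoundedContinuousFunction Circle ℂ} (hg : g ∈ trigSubalgebra) :
    g ∈ Submodule.span ℂ (Set.range zpowBCF) := by
  have h : g ∈ Subalgebra.toSubmodule (Algebra.adjoin ℂ (Set.range zpowBCF)) := hg
  rw [Algebra.adjoin_eq_span, ← MonoidHom.coe_mrange, Submonoid.closure_eq] at h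
  exact h

/-- Convergence of the trigonometric moments to those of the normalized Lebesgue measure implies
weak convergence. -/
theorem tendsto_arcMeasure_of_moments (ν : ℕ → ProbabilityMeasure Circle)
    (h : ∀ k : ℕ, k ≠ 0 → Tendsto (fun n => ∫ z : Circle, (z : ℂ) ^ k ∂(ν n : Measure Circle))
      atTop (𝓝 0)) :
    Tendsto ν atTop (𝓝 arcProbabilityMeasure) := by
  have hint : ∀ (m : Measure Circle) [IsFiniteMeasure m] (g : BoundedContinuousFunction Circle ℂ),
    Integrable g m := fun m _ g => g.integrable m
  refine ProbabilityMeasure.tendsto_of_tight_of_separatesPoints ℂ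
    IsTightMeasureSet.of_compactSpace (A := trigSubalgebra) ?_ ?_
  · intro x y hxy
    refine ⟨_, ⟨_, ⟨zpowBCF (Multiplicative.ofAdd 1),
      Algebra.subset_adjoin ⟨_, rfl⟩, rfl⟩, rfl⟩, ?_⟩
    simpa [zpowBCF, Circle.coe_inj] using hxy
  · intro g hg
    change Tendsto _ _ (𝓝 (∫ z, g z ∂arcMeasure))
    replace hg := mem_trigSubalgebra hg
    induction hg using Submodule.span_induction with
    | mem x hx =>
      obtain ⟨n, rfl⟩ := hx
      obtain ⟨k, hk⟩ := Int.eq_nat_or_neg (Multiplicative.toAdd n)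
      by_cases hk0 : k = 0
      · have : n = 1 := by rw [← toAdd_eq_zero]; omega
        simp [this]
      · rcases hk with hk | hk
        · have : ∀ z : Circle, zpowBCF n z = (z : ℂ) ^ k := by intro z; simp [zpowBCF, hk]
          simp only [this]
          simpa [integral_pow_arcMeasure hk0] using h k hk0
        · have : ∀ z : Circle, zpowBCF n z = conj ((z : ℂ) ^ k) := by
            intro z; simp [zpowBCF, hk, ← Circle.coe_inv_eq_conj]
          simp only [this, integral_conj]
          simpa [integral_pow_arcMeasure hk0, Function.comp_def] using
            (Complex.continuous_conj.tendsto _).comp (h k hk0)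
    | zero => simp
    | add x y hx hy ihx ihy =>
      simp only [BoundedContinuousFunction.coe_add, Pi.add_apply]
      have := ihx.add ihy
      simpa [integral_add, hint] using this
    | smul a x hx ih =>
      simp only [BoundedContinuousFunction.coe_smul, integral_smul]
      exact ih.const_smul a

/-! ### Monic orthogonal polynomials and the Szegő recursion in L² -/

/-- The restriction of a polynomial to the unit circle, as an element of `L²(∂𝔻, dμ)`. -/
def toL2 (μ : Measure Circle) [IsFiniteMeasure μ] : ℂ[X] →ₗ[ℂ] Lp ℂ 2 μ :=
  (ContinuousMap.toLp 2 μ ℂ : C(Circle, ℂ) →L[ℂ] Lp ℂ 2 μ).toLinearMap ∘ₗ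
    (aeval (⟨fun z : Circle => (z : ℂ), continuous_subtype_val⟩ : C(Circle, ℂ))).toLinearMap

theorem monicOP_eq (μ : Measure Circle) (n : ℕ) : monicOP μ n = X ^ n - ∑ k : Fin n,
    C (polyInner μ (monicOP μ k) (X ^ n) / polyInner μ (monicOP μ k) (monicOP μ k)) *
      monicOP μ k := by
  rw [monicOP]

theorem degree_monicOP_sub (μ : Measure Circle) (n : ℕ) :
    (monicOP μ n - X ^ n).degree < (n : WithBot ℕ) := by
  induction n using Nat.strong_induction_on with
  | _ n ih =>
    rw [monicOP_eq, sub_sub_cancel_left, degree_neg]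
    refine (degree_sum_le _ _).trans_lt ?_
    refine (Finset.sup_lt_iff (WithBot.bot_lt_coe n)).2 ?_
    intro k _
    rw [← smul_eq_C_mul]
    refine (degree_smul_le _ _).trans_lt ?_
    have h1 : monicOP μ k = (monicOP μ k - X ^ (k : ℕ)) + X ^ (k : ℕ) := by ring
    rw [h1]
    refine (degree_add_le _ _).trans_lt (max_lt ((ih k k.2).trans ?_) ?_)
    · exact Nat.cast_lt.2 k.2
    · rw [degree_X_pow]; exact Nat.cast_lt.2 k.2

theorem degree_monicOP (μ : Measure Circle) (n : ℕ) : (monicOP μ n).degree = n := by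
  have h1 : monicOP μ n = (monicOP μ n - X ^ n) + X ^ n := by ring
  rw [h1, degree_add_eq_right_of_degree_lt, degree_X_pow]
  rw [degree_X_pow]
  exact degree_monicOP_sub μ n

theorem monic_monicOP (μ : Measure Circle) (n : ℕ) : (monicOP μ n).Monic := by
  have h1 : monicOP μ n = (monicOP μ n - X ^ n) + X ^ n := by ring
  rw [h1]
  refine (monic_X_pow n).add_of_right ?_
  rw [degree_X_pow]
  exact degree_monicOP_sub μ n

theorem coeff_monicOP (μ : Measure Circle) (n : ℕ) : (monicOP μ n).coeff n = 1 := by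
  have h := monic_monicOP μ n
  rwa [Monic, leadingCoeff, natDegree_eq_of_degree_eq_some (degree_monicOP μ n)] at h

theorem degree_sub_lt_of_coeff_eq {n : ℕ} {P Q : ℂ[X]} (hP : P.degree < ((n + 1 : ℕ) : WithBot ℕ))
    (hQ : Q.degree < ((n + 1 : ℕ) : WithBot ℕ)) (h : P.coeff n = Q.coeff n) :
    (P - Q).degree < (n : WithBot ℕ) := by
  rw [degree_lt_iff_coeff_zero] at *
  intro m hm
  rcases hm.eq_or_lt with rfl | hm
  · simp [h]
  · simp [hP m hm, hQ m hm]

theorem degree_monicOP_succ_sub (μ : Measure Circle) (n : ℕ) :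
    (monicOP μ (n + 1) - X * monicOP μ n).degree < ((n + 1 : ℕ) : WithBot ℕ) := by
  refine degree_sub_lt_of_coeff_eq ?_ ?_ (by simp [coeff_monicOP])
  · rw [degree_monicOP]; exact_mod_cast Nat.lt_succ_self _
  · rw [X_mul, degree_mul_X, degree_monicOP]; exact_mod_cast Nat.lt_succ_self _

section L2

variable (μ : Measure Circle) [IsFiniteMeasure μ]

theorem inner_toL2 (P Q : ℂ[X]) : inner ℂ (toL2 μ P) (toL2 μ Q) = polyInner μ P Q := by
  simp only [toL2, LinearMap.comp_apply, AlgHom.toLinearMap_apply, ContinuousLinearMap.coe_coe]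
  rw [ContinuousMap.inner_toLp, polyInner]
  refine integral_congr_ae (Eventually.of_forall fun z => ?_)
  simp only [aeval_continuousMap_apply]
  exact mul_comm _ _

theorem norm_toL2_sq (P : ℂ[X]) : ‖toL2 μ P‖ ^ 2 = ∫ z : Circle, ‖P.eval (z : ℂ)‖ ^ 2 ∂μ := by
  have h := inner_self_eq_norm_sq_to_K (𝕜 := ℂ) (toL2 μ P)
  rw [inner_toL2, polyInner] at h
  simp only [Complex.conj_mul'] at h
  have h2 : ∫ z : Circle, ((‖P.eval (z : ℂ)‖ : ℂ)) ^ 2 ∂μ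
      = ((∫ z : Circle, ‖P.eval (z : ℂ)‖ ^ 2 ∂μ : ℝ) : ℂ) := by
    rw [← integral_complex_ofReal]
    simp
  rw [h2] at h
  refine (Complex.ofReal_injective (h.trans ?_)).symm
  push_cast
  rfl

theorem norm_toL2 (P : ℂ[X]) : ‖toL2 μ P‖ = polyNorm μ P := by
  rw [polyNorm, ← norm_toL2_sq, Real.sqrt_sq (norm_nonneg _)]

theorem norm_toL2_congr {P Q : ℂ[X]} (h : ∀ z : Circle, ‖P.eval (z : ℂ)‖ = ‖Q.eval (z : ℂ)‖) :
    ‖toL2 μ P‖ = ‖toL2 μ Q‖ := by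
  simp only [norm_toL2, polyNorm, h]

theorem norm_toL2_X_mul (P : ℂ[X]) : ‖toL2 μ (X * P)‖ = ‖toL2 μ P‖ :=
  norm_toL2_congr μ fun z => by simp [Circle.norm_coe]

theorem inner_toL2_X_mul (P Q : ℂ[X]) :
    inner ℂ (toL2 μ (X * P)) (toL2 μ (X * Q)) = inner ℂ (toL2 μ P) (toL2 μ Q) := by
  simp only [inner_toL2, polyInner]
  refine integral_congr_ae (Eventually.of_forall fun z => ?_)
  have h : conj (z : ℂ) * (z : ℂ) = 1 := by rw [Complex.conj_mul', Circle.norm_coe]; simp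
  simp only [eval_mul, eval_X, map_mul]
  linear_combination (conj (P.eval (z : ℂ)) * Q.eval (z : ℂ)) * h

theorem inner_toL2_eq_zero {n : ℕ} {P : ℂ[X]} (hP : P.degree < (n : WithBot ℕ)) (v : Lp ℂ 2 μ)
    (hv : ∀ i < n, inner ℂ (toL2 μ (X ^ i)) v = 0) : inner ℂ (toL2 μ P) v = 0 := by
  by_cases h0 : P = 0
  · simp [h0]
  rw [P.as_sum_range' n ((natDegree_lt_iff_degree_lt h0).2 hP), map_sum, sum_inner]
  refine Finset.sum_eq_zero fun i hi => ?_
  rw [← C_mul_X_pow_eq_monomial, ← smul_eq_C_mul, map_smul, inner_smul_left,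
    hv i (Finset.mem_range.1 hi), mul_zero]

theorem inner_monicOP_of_lt {m n : ℕ} (h : m < n) :
    inner ℂ (toL2 μ (monicOP μ m)) (toL2 μ (monicOP μ n)) = 0 := by
  induction n using Nat.strong_induction_on generalizing m with
  | _ n ih =>
    have hoff : ∀ k < n, k ≠ m →
        inner ℂ (toL2 μ (monicOP μ m)) (toL2 μ (monicOP μ k)) = 0 := by
      intro k hk hkm
      rcases hkm.lt_or_gt with hlt | hlt
      · rw [← inner_conj_symm, ih m h hlt, map_zero]
      · exact ih k hk hlt
    rw [monicOP_eq μ n, map_sub, map_sum, inner_sub_right, inner_sum,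
      Finset.sum_eq_single (⟨m, h⟩ : Fin n)]
    · rw [← smul_eq_C_mul, map_smul, inner_smul_right, ← inner_toL2, ← inner_toL2, sub_eq_zero]
      -- Without nondegeneracy the Gram–Schmidt coefficient may divide by zero, but then Φ_m
      -- vanishes in L².
      by_cases h0 : inner ℂ (toL2 μ (monicOP μ m)) (toL2 μ (monicOP μ m)) = 0
      · rw [h0, mul_zero, inner_self_eq_zero.1 h0, inner_zero_left]
      · rw [div_mul_cancel₀ _ h0]
    · intro k _ hk
      rw [← smul_eq_C_mul, map_smul, inner_smul_right, hoff k k.2 (fun e => hk (Fin.ext e)),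
        mul_zero]
    · simp

theorem inner_eq_zero_of_forall_monicOP {n : ℕ} {P : ℂ[X]} (hP : P.degree < (n : WithBot ℕ))
    (v : Lp ℂ 2 μ)
    (hv : ∀ i < n, inner ℂ (toL2 μ (monicOP μ i)) v = 0) : inner ℂ (toL2 μ P) v = 0 := by
  induction n generalizing P with
  | zero =>
    have : P = 0 := by rwa [Nat.cast_zero, Nat.WithBot.lt_zero_iff, degree_eq_bot] at hP
    simp [this]
  | succ n ih =>
    have h : P = (P - P.coeff n • monicOP μ n) + P.coeff n • monicOP μ n := by ring
    rw [h, map_add, inner_add_left, map_smul, inner_smul_left, hv n n.lt_succ_self, mul_zero,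
      add_zero]
    refine ih (degree_sub_lt_of_coeff_eq hP ?_ (by simp [coeff_monicOP]))
      (fun i hi => hv i (hi.trans n.lt_succ_self))
    refine (degree_smul_le _ _).trans_lt ?_
    rw [degree_monicOP]
    exact_mod_cast n.lt_succ_self

theorem inner_monicOP_of_degree_lt {n : ℕ} {P : ℂ[X]} (hP : P.degree < (n : WithBot ℕ)) :
    inner ℂ (toL2 μ P) (toL2 μ (monicOP μ n)) = 0 :=
  inner_eq_zero_of_forall_monicOP μ hP _ fun _ hi => inner_monicOP_of_lt μ hi

theorem inner_X_pow_monicOP {i n : ℕ} (h : i < n) :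
    inner ℂ (toL2 μ (X ^ i)) (toL2 μ (monicOP μ n)) = 0 :=
  inner_monicOP_of_degree_lt μ (by rw [degree_X_pow]; exact_mod_cast h)

/-- The Szegő recursion, in the form of the norm of `Φ_{n+1} - z Φ_n`. -/
theorem norm_monicOP_succ_sub (n : ℕ) :
    ‖toL2 μ (monicOP μ (n + 1) - X * monicOP μ n)‖ =
      ‖verblunsky μ n‖ * ‖toL2 μ (monicOP μ n)‖ := by
  set Q := monicOP μ (n + 1) - X * monicOP μ n with hQ
  have hQd : Q.degree < ((n + 1 : ℕ) : WithBot ℕ) := degree_monicOP_succ_sub μ n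
  -- The reversed polynomial `R` = Q^* has the same modulus as `Q` on the circle. Reversal turns
  -- orthogonality of `Q` to z, …, z^n into orthogonality of `R` to 1, …, z^{n-1}.
  set R := reflect n (Q.map (starRingEnd ℂ)) with hR
  have hdeg : (Q.map (starRingEnd ℂ)).natDegree ≤ n := by
    refine natDegree_map_le.trans (natDegree_le_iff_coeff_eq_zero.2 ?_)
    exact fun m hm => (degree_lt_iff_coeff_zero _ _).1 hQd m hm
  have hev : ∀ z : Circle, R.eval (z : ℂ) = (z : ℂ) ^ n * conj (Q.eval (z : ℂ)) := by
    intro z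
    have hz : (z : ℂ) ≠ 0 := z.coe_ne_zero
    let : Invertible ((z : ℂ)⁻¹) := invertibleOfNonzero (inv_ne_zero hz)
    have h := eval₂_reflect_mul_pow (RingHom.id ℂ) ((z : ℂ)⁻¹) n _ hdeg
    rw [invOf_eq_inv, inv_inv, ← hR] at h
    have h2 : eval₂ (RingHom.id ℂ) (z : ℂ)⁻¹ (Q.map (starRingEnd ℂ)) = conj (Q.eval (z : ℂ)) := by
      rw [← Circle.coe_inv, Circle.coe_inv_eq_conj, ← eval_map, Polynomial.map_id, eval_map,
        eval₂_hom]
    rw [h2, inv_pow] at h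
    rw [← h]
    change eval₂ (RingHom.id ℂ) (z : ℂ) R = _
    field_simp
  have hnorm : ‖toL2 μ Q‖ = ‖toL2 μ R‖ := norm_toL2_congr μ fun z => by
    rw [hev]; simp [Circle.norm_coe]
  have hQz : ∀ m, 1 ≤ m → m ≤ n → inner ℂ (toL2 μ (X ^ m)) (toL2 μ Q) = 0 := by
    intro m hm hmn
    obtain ⟨m, rfl⟩ := Nat.exists_eq_add_of_le' hm
    rw [hQ, map_sub, inner_sub_right, inner_X_pow_monicOP μ (by omega), pow_succ', inner_toL2_X_mul,
      inner_X_pow_monicOP μ (by omega), sub_zero]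
  have hRz : ∀ i < n, inner ℂ (toL2 μ (X ^ i)) (toL2 μ R) = 0 := by
    intro i hi
    have h := hQz (n - i) (by omega) (by omega)
    rw [inner_toL2, polyInner] at h ⊢
    have h2 := congrArg conj h
    rw [← integral_conj, map_zero] at h2
    rw [← h2]
    refine integral_congr_ae (Eventually.of_forall fun z => ?_)
    have hz : conj (z : ℂ) * (z : ℂ) = 1 := by rw [Complex.conj_mul', Circle.norm_coe]; simp
    have hn : (z : ℂ) ^ n = (z : ℂ) ^ i * (z : ℂ) ^ (n - i) := by rw [← pow_add]; congr 1; omega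
    have hzi : conj ((z : ℂ) ^ i) * (z : ℂ) ^ i = 1 := by rw [map_pow, ← mul_pow, hz, one_pow]
    simp only [hev, eval_pow, eval_X, map_mul, Complex.conj_conj, hn]
    linear_combination ((z : ℂ) ^ (n - i) * conj (Q.eval (z : ℂ))) * hzi
  have hQ0 : Q.coeff 0 = (monicOP μ (n + 1)).eval 0 := by
    simp [hQ, coeff_zero_eq_eval_zero]
  have hRn : R.coeff n = conj (Q.coeff 0) := by
    rw [hR, coeff_reflect, revAt_le le_rfl, Nat.sub_self, coeff_map]
  have hRd : R.degree < ((n + 1 : ℕ) : WithBot ℕ) := by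
    rw [degree_lt_iff_coeff_zero]
    intro m hm
    rw [hR, coeff_reflect, revAt_eq_self_of_lt (by omega)]
    exact coeff_eq_zero_of_natDegree_lt (by omega)
  -- Cancelling the z^n coefficient leaves a polynomial of degree below n orthogonal to all such
  -- polynomials, hence zero in L².
  have hd : (R - conj (Q.coeff 0) • monicOP μ n).degree < (n : WithBot ℕ) := by
    refine degree_sub_lt_of_coeff_eq hRd ?_ (by simp [coeff_monicOP, hRn])
    refine (degree_smul_le _ _).trans_lt ?_
    rw [degree_monicOP]
    exact_mod_cast n.lt_succ_self
  have hz : inner ℂ (toL2 μ (R - conj (Q.coeff 0) • monicOP μ n))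
      (toL2 μ (R - conj (Q.coeff 0) • monicOP μ n)) = 0 := by
    refine inner_toL2_eq_zero μ hd _ fun i hi => ?_
    rw [map_sub, inner_sub_right, hRz i hi, map_smul, inner_smul_right, inner_X_pow_monicOP μ hi,
      mul_zero, sub_zero]
  rw [inner_self_eq_zero, map_sub, sub_eq_zero, map_smul] at hz
  rw [hnorm, hz, norm_smul, hQ0, verblunsky, norm_neg]

/-- Pythagoras: zΦ_n is Φ_{n+1} minus a vector orthogonal to it of norm |α_n| ‖Φ_n‖, while ‖zΦ_n‖ =
‖Φ_n‖. -/
theorem norm_verblunsky_le_one {n : ℕ} (h : toL2 μ (monicOP μ n) ≠ 0) : ‖verblunsky μ n‖ ≤ 1 := by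
  have h1 : inner ℂ (toL2 μ (monicOP μ (n + 1) - X * monicOP μ n))
      (toL2 μ (monicOP μ (n + 1))) = 0 :=
    inner_monicOP_of_degree_lt μ (degree_monicOP_succ_sub μ n)
  have h2 : ‖toL2 μ (monicOP μ (n + 1) - X * monicOP μ n)‖ ≤ ‖toL2 μ (X * monicOP μ n)‖ := by
    have h3 : toL2 μ (X * monicOP μ n) = -toL2 μ (monicOP μ (n + 1) - X * monicOP μ n) +
        toL2 μ (monicOP μ (n + 1)) := by
      rw [map_sub]; abel
    have h4 := norm_add_sq_eq_norm_sq_add_norm_sq_of_inner_eq_zero (𝕜 := ℂ)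
      (-toL2 μ (monicOP μ (n + 1) - X * monicOP μ n)) (toL2 μ (monicOP μ (n + 1)))
      (by rw [inner_neg_left, h1, neg_zero])
    rw [← h3, norm_neg] at h4
    nlinarith [norm_nonneg (toL2 μ (monicOP μ (n + 1))), norm_nonneg (toL2 μ (X * monicOP μ n)),
      norm_nonneg (toL2 μ (monicOP μ (n + 1) - X * monicOP μ n))]
  rw [norm_monicOP_succ_sub, norm_toL2_X_mul] at h2
  exact le_of_mul_le_mul_right (by linarith) (norm_pos_iff.2 h)

end L2

/-! ### Orthonormal polynomials and their behaviour under multiplication by z -/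

/-- Polynomials are determined by their class in `L²(∂𝔻, dμ)`, that is, `μ` has infinite
support. -/
def IsNondegenerate (μ : Measure Circle) [IsFiniteMeasure μ] : Prop :=
  ∀ P : ℂ[X], toL2 μ P = 0 → P = 0

section Nondegenerate

variable {μ : Measure Circle} [IsFiniteMeasure μ]

theorem IsNondegenerate.toL2_monicOP_ne_zero (hμ : IsNondegenerate μ) (n : ℕ) :
    toL2 μ (monicOP μ n) ≠ 0 :=
  fun h => (monic_monicOP μ n).ne_zero (hμ _ h)

theorem toL2_normOP (n : ℕ) :
    toL2 μ (normOP μ n) = ((‖toL2 μ (monicOP μ n)‖ : ℂ)⁻¹) • toL2 μ (monicOP μ n) := by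
  rw [normOP, ← smul_eq_C_mul, map_smul, norm_toL2]

theorem IsNondegenerate.orthonormal (hμ : IsNondegenerate μ) :
    Orthonormal ℂ fun n => toL2 μ (normOP μ n) := by
  constructor
  · intro n
    have h := norm_ne_zero_iff.2 (hμ.toL2_monicOP_ne_zero n)
    beta_reduce
    rw [toL2_normOP, norm_smul, norm_inv, Complex.norm_real, norm_norm, inv_mul_cancel₀ h]
  · intro m n hmn
    have h0 : inner ℂ (toL2 μ (monicOP μ m)) (toL2 μ (monicOP μ n)) = 0 := by
      rcases hmn.lt_or_gt with h | h
      · exact inner_monicOP_of_lt μ h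
      · rw [← inner_conj_symm, inner_monicOP_of_lt μ h, map_zero]
    simp only [toL2_normOP, inner_smul_left, inner_smul_right, h0, mul_zero]

/-- One |α_n| comes from the Szegő recursion, the other from the change of normalization between Φ_n
and Φ_{n+1}. -/
theorem IsNondegenerate.norm_X_mul_normOP_sub_le (hμ : IsNondegenerate μ) (n : ℕ) :
    ‖toL2 μ (X * normOP μ n - normOP μ (n + 1))‖ ≤ 2 * ‖verblunsky μ n‖ := by
  set a := ‖toL2 μ (monicOP μ n)‖ with ha
  set b := ‖toL2 μ (monicOP μ (n + 1))‖ with hb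
  have ha0 : 0 < a := norm_pos_iff.2 (hμ.toL2_monicOP_ne_zero n)
  have hb0 : 0 < b := norm_pos_iff.2 (hμ.toL2_monicOP_ne_zero (n + 1))
  have hac : (a : ℂ) ≠ 0 := by exact_mod_cast ha0.ne'
  have hbc : (b : ℂ) ≠ 0 := by exact_mod_cast hb0.ne'
  have hX : toL2 μ (X * normOP μ n) = (a : ℂ)⁻¹ • toL2 μ (X * monicOP μ n) := by
    rw [normOP, mul_left_comm, ← smul_eq_C_mul, map_smul, ← norm_toL2]
  have hrec := norm_monicOP_succ_sub μ n
  rw [← ha] at hrec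
  have hab : |b - a| ≤ ‖verblunsky μ n‖ * a := by
    rw [← hrec, map_sub, hb, ha, ← norm_toL2_X_mul μ (monicOP μ n)]
    exact abs_norm_sub_norm_le (toL2 μ (monicOP μ (n + 1))) (toL2 μ (X * monicOP μ n))
  have heq : toL2 μ (X * normOP μ n - normOP μ (n + 1)) =
      -((a : ℂ)⁻¹ • toL2 μ (monicOP μ (n + 1) - X * monicOP μ n)) +
        ((a : ℂ)⁻¹ - (b : ℂ)⁻¹) • toL2 μ (monicOP μ (n + 1)) := by
    rw [map_sub, hX, toL2_normOP, map_sub, sub_smul, smul_sub]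
    abel
  rw [heq]
  refine (norm_add_le _ _).trans ?_
  rw [norm_neg, norm_smul, norm_smul, hrec, ← hb, norm_inv, Complex.norm_real, ha, norm_norm, ← ha]
  have h1 : ‖(a : ℂ)⁻¹ - (b : ℂ)⁻¹‖ * b = |b - a| / a := by
    rw [inv_sub_inv hac hbc, norm_div, norm_mul, ← Complex.ofReal_sub, Complex.norm_real,
      Complex.norm_real, Complex.norm_real, Real.norm_eq_abs, Real.norm_of_nonneg ha0.le,
      Real.norm_of_nonneg hb0.le]
    field_simp
  rw [h1]
  have h2 : |b - a| / a ≤ ‖verblunsky μ n‖ := by rwa [div_le_iff₀ ha0]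
  have h3 : a⁻¹ * (‖verblunsky μ n‖ * a) = ‖verblunsky μ n‖ := by field_simp
  linarith

theorem IsNondegenerate.norm_X_pow_mul_normOP_sub_le (hμ : IsNondegenerate μ) (j k : ℕ) :
    ‖toL2 μ (X ^ k * normOP μ j - normOP μ (j + k))‖ ≤
      2 * ∑ i ∈ Finset.range k, ‖verblunsky μ (j + i)‖ := by
  induction k with
  | zero => simp
  | succ k ih =>
    have h : X ^ (k + 1) * normOP μ j - normOP μ (j + (k + 1)) =
        X * (X ^ k * normOP μ j - normOP μ (j + k)) +
          (X * normOP μ (j + k) - normOP μ (j + k + 1)) := by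
      rw [← add_assoc]; ring
    rw [h, map_add, Finset.sum_range_succ, mul_add]
    refine (norm_add_le _ _).trans (add_le_add ?_ (hμ.norm_X_mul_normOP_sub_le _))
    rw [norm_toL2_X_mul]
    exact ih

/-- The moment is ⟨φ_j, z^k φ_j⟩; since φ_j ⟂ φ_{j+k}, subtracting φ_{j+k} is free, and
Cauchy–Schwarz applies. -/
theorem IsNondegenerate.norm_moment_normOP_le (hμ : IsNondegenerate μ) (j : ℕ) {k : ℕ}
    (hk : k ≠ 0) :
    ‖∫ z : Circle, (z : ℂ) ^ k * ((‖(normOP μ j).eval (z : ℂ)‖ ^ 2 : ℝ) : ℂ) ∂μ‖ ≤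
      2 * ∑ i ∈ Finset.range k, ‖verblunsky μ (j + i)‖ := by
  have h1 : ∫ z : Circle, (z : ℂ) ^ k * ((‖(normOP μ j).eval (z : ℂ)‖ ^ 2 : ℝ) : ℂ) ∂μ =
      inner ℂ (toL2 μ (normOP μ j)) (toL2 μ (X ^ k * normOP μ j)) := by
    rw [inner_toL2, polyInner]
    refine integral_congr_ae (Eventually.of_forall fun z => ?_)
    simp only [eval_mul, eval_pow, eval_X, Complex.ofReal_pow, ← Complex.conj_mul']
    ring
  have h2 : inner ℂ (toL2 μ (normOP μ j)) (toL2 μ (X ^ k * normOP μ j)) =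
      inner ℂ (toL2 μ (normOP μ j)) (toL2 μ (X ^ k * normOP μ j - normOP μ (j + k))) := by
    rw [map_sub, inner_sub_right, hμ.orthonormal.2 (show j ≠ j + k by omega), sub_zero]
  rw [h1, h2]
  refine (norm_inner_le_norm _ _).trans ?_
  rw [hμ.orthonormal.1 j, one_mul]
  exact hμ.norm_X_pow_mul_normOP_sub_le j k

/-- The Christoffel–Darboux kernel on the diagonal bounds point evaluation. -/
theorem IsNondegenerate.norm_eval_sq_le (hμ : IsNondegenerate μ) {n : ℕ} {P : ℂ[X]}
    (hP : P.degree < ((n + 1 : ℕ) : WithBot ℕ)) (x : ℂ) :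
    ‖P.eval x‖ ^ 2 ≤ (∑ j ∈ Finset.range (n + 1), ‖(normOP μ j).eval x‖ ^ 2) * ‖toL2 μ P‖ ^ 2 := by
  set c : ℕ → ℂ := fun j => inner ℂ (toL2 μ (normOP μ j)) (toL2 μ P) with hc
  -- The residual of the orthonormal expansion of `P` is zero, so `P.eval x` is a finite sum to
  -- which Cauchy–Schwarz and Bessel apply.
  set Q := P - ∑ j ∈ Finset.range (n + 1), c j • normOP μ j with hQ
  have hdeg : Q.degree < ((n + 1 : ℕ) : WithBot ℕ) := by
    refine (degree_sub_le _ _).trans_lt (max_lt hP ((degree_sum_le _ _).trans_lt ?_))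
    refine (Finset.sup_lt_iff (WithBot.bot_lt_coe (n + 1))).2 fun j hj => ?_
    rw [normOP, ← smul_eq_C_mul, smul_smul]
    refine (degree_smul_le _ _).trans_lt ?_
    rw [degree_monicOP]
    exact Nat.cast_lt.2 (Finset.mem_range.1 hj)
  have horth : ∀ i < n + 1, inner ℂ (toL2 μ (normOP μ i)) (toL2 μ Q) = 0 := by
    intro i hi
    simp only [hQ, map_sub, map_sum, map_smul, inner_sub_right]
    rw [hμ.orthonormal.inner_right_sum _ (Finset.mem_range.2 hi), hc, sub_self]
  have hQ0 : Q = 0 := by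
    refine hμ _ (inner_self_eq_zero (𝕜 := ℂ).1 ?_)
    refine inner_eq_zero_of_forall_monicOP μ hdeg _ fun i hi => ?_
    have h := horth i hi
    rw [toL2_normOP, inner_smul_left, mul_eq_zero] at h
    refine h.resolve_left ?_
    simpa using hμ.toL2_monicOP_ne_zero i
  have hPe : P.eval x = ∑ j ∈ Finset.range (n + 1), c j * (normOP μ j).eval x := by
    rw [sub_eq_zero.1 hQ0, eval_finsetSum]
    simp
  have hbessel := hμ.orthonormal.sum_inner_products_le (toL2 μ P) (s := Finset.range (n + 1))
  calc ‖P.eval x‖ ^ 2 ≤ (∑ j ∈ Finset.range (n + 1), ‖c j‖ * ‖(normOP μ j).eval x‖) ^ 2 := by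
        rw [hPe]
        gcongr
        exact (norm_sum_le _ _).trans_eq (by simp)
    _ ≤ (∑ j ∈ Finset.range (n + 1), ‖c j‖ ^ 2) *
        ∑ j ∈ Finset.range (n + 1), ‖(normOP μ j).eval x‖ ^ 2 :=
        Finset.sum_mul_sq_le_sq_mul_sq _ _ _
    _ ≤ _ := by
        rw [mul_comm]
        gcongr

end Nondegenerate

/-! ### Regularity and Cesàro means of the Verblunsky coefficients -/

/-- The Cesàro means of the moduli of the Verblunsky coefficients of a regular measure tend
to zero. -/
theorem IsRegularCircle.tendsto_average_norm_verblunsky {μ : Measure Circle}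
    (hreg : IsRegularCircle μ) (hα : ∀ n, ‖verblunsky μ n‖ ≤ 1) :
    Tendsto (fun n : ℕ => (∑ j ∈ Finset.range (n + 1), ‖verblunsky μ j‖) / ((n : ℝ) + 1))
      atTop (𝓝 0) := by
  have hreg' : Tendsto (fun n : ℕ => (∏ j ∈ Finset.Icc 1 n, rho μ j) ^ (1 / (n : ℝ)))
    atTop (𝓝 1) := hreg
  set b : ℕ → ℝ := fun n => (∏ j ∈ Finset.Icc 1 n, rho μ j) ^ (1 / (n : ℝ)) with hb
  -- The first term pays for |α_0|, as the product defining regularity starts at ρ_1; the second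
  -- comes from AM–GM for ρ_1, …, ρ_n, the bound √(1-t) ≤ 1 - t/2, and Cauchy–Schwarz.
  have hlim : Tendsto (fun n : ℕ => 1 / ((n : ℝ) + 1) + Real.sqrt (2 * (1 - b n))) atTop (𝓝 0) := by
    have h1 : Tendsto (fun n : ℕ => Real.sqrt (2 * (1 - b n))) atTop (𝓝 0) := by
      have := ((hreg'.const_sub 1).const_mul 2).sqrt
      simpa using this
    simpa using tendsto_one_div_add_atTop_nhds_zero_nat.add h1
  have hrho : ∀ j, rho μ j ≤ 1 - ‖verblunsky μ j‖ ^ 2 / 2 := by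
    intro j
    refine Real.sqrt_le_iff.2 ⟨by nlinarith [hα j, norm_nonneg (verblunsky μ j)], ?_⟩
    nlinarith [sq_nonneg (‖verblunsky μ j‖ ^ 2)]
  refine tendsto_of_tendsto_of_tendsto_of_le_of_le' tendsto_const_nhds hlim
    (Eventually.of_forall fun n => by positivity) ?_
  filter_upwards [eventually_ge_atTop 1] with n hn
  have hn0 : (0 : ℝ) < n := by exact_mod_cast hn
  set A := ∑ j ∈ Finset.Icc 1 n, ‖verblunsky μ j‖ with hA
  set S := ∑ j ∈ Finset.Icc 1 n, ‖verblunsky μ j‖ ^ 2 with hS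
  have hamgm : b n ≤ 1 - S / (2 * n) := by
    have h := Real.geom_mean_le_arith_mean_weighted (Finset.Icc 1 n) (fun _ => 1 / (n : ℝ)) (rho μ)
      (fun _ _ => by positivity) (by simp [hn0.ne']) (fun _ _ => Real.sqrt_nonneg _)
    rw [Real.finsetProd_rpow _ (rho μ) (fun _ _ => Real.sqrt_nonneg _)] at h
    refine h.trans ?_
    calc ∑ j ∈ Finset.Icc 1 n, 1 / (n : ℝ) * rho μ j
        ≤ ∑ j ∈ Finset.Icc 1 n, 1 / (n : ℝ) * (1 - ‖verblunsky μ j‖ ^ 2 / 2) := by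
          gcongr with j _
          exact hrho j
      _ = 1 - S / (2 * n) := by
          rw [← Finset.mul_sum, Finset.sum_sub_distrib, ← Finset.sum_div, ← hS]
          simp only [Finset.sum_const, Nat.card_Icc, add_tsub_cancel_right, nsmul_eq_mul, mul_one]
          field_simp
  have hcs : A ^ 2 ≤ n * S := by
    have h := sq_sum_le_card_mul_sum_sq (s := Finset.Icc 1 n) (f := fun j => ‖verblunsky μ j‖)
    simpa using h
  have hAn : A / n ≤ Real.sqrt (2 * (1 - b n)) := by
    refine Real.le_sqrt_of_sq_le ?_
    have h1 : (A / n) ^ 2 ≤ S / n := by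
      rw [div_pow, div_le_div_iff₀ (by positivity) hn0]
      nlinarith
    have h2 : S / n = 2 * (S / (2 * n)) := by field_simp
    linarith
  have hsum : ∑ j ∈ Finset.range (n + 1), ‖verblunsky μ j‖ = ‖verblunsky μ 0‖ + A := by
    rw [Finset.sum_range_succ', add_comm, hA, Finset.range_eq_Ico,
      Finset.sum_Ico_add' (fun j => ‖verblunsky μ j‖) 0 n 1]
    rfl
  have hA0 : 0 ≤ A := Finset.sum_nonneg fun _ _ => norm_nonneg _
  rw [hsum, add_div]
  refine add_le_add (by gcongr; exact hα 0) (le_trans ?_ hAn)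
  gcongr
  linarith

/-- Each unit shift of the window exchanges one term in [0, 1] for another, at a cost of at most 1.
-/
theorem sum_shift_norm_verblunsky_le {μ : Measure Circle} (hα : ∀ n, ‖verblunsky μ n‖ ≤ 1)
    (N i : ℕ) : ∑ j ∈ Finset.range N, ‖verblunsky μ (j + i)‖ ≤
      (∑ j ∈ Finset.range N, ‖verblunsky μ j‖) + i := by
  induction i with
  | zero => simp
  | succ i ih =>
    have h : ∑ j ∈ Finset.range N, ‖verblunsky μ (j + (i + 1))‖ + ‖verblunsky μ (0 + i)‖ =
        ∑ j ∈ Finset.range N, ‖verblunsky μ (j + i)‖ + ‖verblunsky μ (N + i)‖ := by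
      rw [← Finset.sum_range_succ (fun j => ‖verblunsky μ (j + i)‖), Finset.sum_range_succ']
      congr 1
      exact Finset.sum_congr rfl fun j _ => by rw [add_right_comm, add_assoc]
    push_cast
    linarith [hα (N + i), norm_nonneg (verblunsky μ (0 + i))]

/-! ### Weak convergence of the Christoffel–Darboux measures -/

/-- The normalized diagonal Christoffel–Darboux kernel `K_n(z, z) / (n + 1)`. -/
def cdDensity (μ : Measure Circle) (n : ℕ) (z : Circle) : ℝ :=
  (∑ j ∈ Finset.range (n + 1), ‖(normOP μ j).eval (z : ℂ)‖ ^ 2) / ((n : ℝ) + 1)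

theorem cdKernel_self (μ : Measure Circle) (n : ℕ) (z : Circle) :
    1 / ((n : ℂ) + 1) * cdKernel μ n z z = (cdDensity μ n z : ℂ) := by
  simp only [cdKernel, cdDensity, Complex.conj_mul']
  push_cast
  ring

theorem continuous_cdDensity (μ : Measure Circle) (n : ℕ) : Continuous (cdDensity μ n) := by
  unfold cdDensity
  refine Continuous.div_const (continuous_finsetSum _ fun j _ => ?_) _
  exact (((normOP μ j).continuous.comp continuous_subtype_val).norm).pow 2

theorem cdDensity_nonneg (μ : Measure Circle) (n : ℕ) (z : Circle) : 0 ≤ cdDensity μ n z := by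
  unfold cdDensity
  positivity

theorem integrable_of_continuous {E : Type*} [NormedAddCommGroup E] {X : Type*}
    [TopologicalSpace X] [CompactSpace X] [MeasurableSpace X] [OpensMeasurableSpace X]
    [SecondCountableTopologyEither X E]
    {ν : Measure X} [IsFiniteMeasure ν] {f : X → E}
    (hf : Continuous f) : Integrable f ν :=
  hf.integrable_of_hasCompactSupport (HasCompactSupport.of_compactSpace f)

section

variable {μ : Measure Circle} [IsFiniteMeasure μ]

theorem integral_cdDensity_smul {n : ℕ} {f : Circle → ℂ} (hf : Continuous f) :
    ∫ z, f z * (cdDensity μ n z : ℂ) ∂μ =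
      (∑ j ∈ Finset.range (n + 1),
        ∫ z : Circle, f z * ((‖(normOP μ j).eval (z : ℂ)‖ ^ 2 : ℝ) : ℂ) ∂μ) / ((n : ℂ) + 1) := by
  rw [← integral_finsetSum, ← integral_div]
  · refine integral_congr_ae (Eventually.of_forall fun z => ?_)
    simp only [cdDensity, ← Finset.mul_sum]
    push_cast
    ring
  · intro j _
    refine integrable_of_continuous (hf.mul ?_)
    exact Complex.continuous_ofReal.comp
      ((((normOP μ j).continuous.comp continuous_subtype_val).norm).pow 2)

theorem IsNondegenerate.integral_cdDensity (hμ : IsNondegenerate μ) (n : ℕ) :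
    ∫ z, cdDensity μ n z ∂μ = 1 := by
  have h := integral_cdDensity_smul (μ := μ) (n := n) (f := fun _ => 1) continuous_const
  have h1 : ∀ j, ∫ z : Circle, ((‖(normOP μ j).eval (z : ℂ)‖ ^ 2 : ℝ) : ℂ) ∂μ = 1 := by
    intro j
    rw [integral_complex_ofReal, ← norm_toL2_sq, hμ.orthonormal.1 j]
    simp
  simp only [one_mul, h1, integral_complex_ofReal] at h
  have hn : (n : ℂ) + 1 ≠ 0 := by exact_mod_cast n.succ_ne_zero
  apply Complex.ofReal_injective
  rw [h]
  simp [hn]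

/-- The probability measure `K_n(z, z) / (n + 1) dμ`. -/
def cdMeasure (μ : Measure Circle) (n : ℕ) : Measure Circle :=
  μ.withDensity fun z => ENNReal.ofReal (cdDensity μ n z)

theorem IsNondegenerate.isProbabilityMeasure_cdMeasure (hμ : IsNondegenerate μ) (n : ℕ) :
    IsProbabilityMeasure (cdMeasure μ n) := by
  constructor
  rw [cdMeasure, withDensity_apply _ MeasurableSet.univ, Measure.restrict_univ,
    ← ofReal_integral_eq_lintegral_ofReal (integrable_of_continuous (continuous_cdDensity μ n))
      (Eventually.of_forall (cdDensity_nonneg μ n)), hμ.integral_cdDensity, ENNReal.ofReal_one]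

/-- `cdMeasure` as a term of `ProbabilityMeasure`. -/
def IsNondegenerate.cdProbabilityMeasure (hμ : IsNondegenerate μ) (n : ℕ) :
    ProbabilityMeasure Circle :=
  ⟨cdMeasure μ n, hμ.isProbabilityMeasure_cdMeasure n⟩

/-- Averaging the moment bounds over j ≤ n gives, for fixed k, a sum of k shifted Cesàro means of
|α_j|, each tending to 0. -/
theorem IsNondegenerate.tendsto_cdMeasure (hμ : IsNondegenerate μ) (hreg : IsRegularCircle μ) :
    Tendsto hμ.cdProbabilityMeasure atTop (𝓝 arcProbabilityMeasure) := by
  refine tendsto_arcMeasure_of_moments _ fun k hk => ?_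
  have hα : ∀ n, ‖verblunsky μ n‖ ≤ 1 := fun n =>
    norm_verblunsky_le_one μ (hμ.toL2_monicOP_ne_zero n)
  have hav := hreg.tendsto_average_norm_verblunsky hα
  set a : ℕ → ℝ := fun n => (∑ j ∈ Finset.range (n + 1), ‖verblunsky μ j‖) / ((n : ℝ) + 1) with ha
  have hlim : Tendsto (fun n : ℕ => 2 * ∑ i ∈ Finset.range k, (a n + i * (1 / ((n : ℝ) + 1))))
      atTop (𝓝 0) := by
    have h : ∀ i ∈ Finset.range k,
        Tendsto (fun n : ℕ => a n + i * (1 / ((n : ℝ) + 1))) atTop (𝓝 0) := fun i _ => by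
      simpa using hav.add (tendsto_one_div_add_atTop_nhds_zero_nat.const_mul (i : ℝ))
    simpa using (tendsto_finsetSum _ h).const_mul 2
  refine squeeze_zero_norm (fun n => ?_) hlim
  have hmom : ∫ z : Circle, (z : ℂ) ^ k ∂(cdMeasure μ n) =
      ∫ z : Circle, (z : ℂ) ^ k * (cdDensity μ n z : ℂ) ∂μ := by
    rw [cdMeasure, integral_withDensity_eq_integral_toReal_smul
      (continuous_cdDensity μ n).measurable.ennreal_ofReal
      (Eventually.of_forall fun _ => ENNReal.ofReal_lt_top)]
    refine integral_congr_ae (Eventually.of_forall fun z => ?_)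
    simp only [ENNReal.toReal_ofReal (cdDensity_nonneg μ n z), Complex.real_smul]
    ring
  have hn : (0 : ℝ) < (n : ℝ) + 1 := by positivity
  have hnn : ‖(n : ℂ) + 1‖ = (n : ℝ) + 1 := by exact_mod_cast Complex.norm_natCast (n + 1)
  change ‖∫ z : Circle, (z : ℂ) ^ k ∂(cdMeasure μ n)‖ ≤ _
  rw [hmom, integral_cdDensity_smul (f := fun z : Circle => (z : ℂ) ^ k) (by fun_prop), norm_div,
    hnn,
    div_le_iff₀ hn]
  calc _ ≤ ∑ j ∈ Finset.range (n + 1), 2 * ∑ i ∈ Finset.range k, ‖verblunsky μ (j + i)‖ :=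
        (norm_sum_le _ _).trans (Finset.sum_le_sum fun j _ => hμ.norm_moment_normOP_le j hk)
    _ = 2 * ∑ i ∈ Finset.range k, ∑ j ∈ Finset.range (n + 1), ‖verblunsky μ (j + i)‖ := by
        rw [← Finset.mul_sum, Finset.sum_comm]
    _ ≤ 2 * ∑ i ∈ Finset.range k, ((∑ j ∈ Finset.range (n + 1), ‖verblunsky μ j‖) + i) := by
        gcongr with i _
        exact sum_shift_norm_verblunsky_le hα _ _
    _ = _ := by
        rw [mul_assoc, Finset.sum_mul]
        congr 1
        refine Finset.sum_congr rfl fun i _ => ?_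
        simp only [ha]
        field_simp

/-- Portmanteau theorem: the boundary of an arc is countable, hence Lebesgue-null. -/
theorem IsNondegenerate.tendsto_setIntegral_cdDensity (hμ : IsNondegenerate μ)
    (hreg : IsRegularCircle μ) {I : Set Circle} (hI : IsArc I) :
    Tendsto (fun n => ∫ z in I, cdDensity μ n z ∂μ) atTop (𝓝 (arcMeasure.real I)) := by
  have hfr : arcMeasure (frontier I) = 0 := hI.frontier_countable.measure_zero _
  have h := ProbabilityMeasure.tendsto_measure_of_null_frontier_of_tendsto'
    (hμ.tendsto_cdMeasure hreg) (E := I) hfr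
  have h2 := (ENNReal.tendsto_toReal (measure_ne_top arcMeasure I)).comp h
  refine h2.congr fun n => ?_
  change (cdMeasure μ n I).toReal = _
  rw [cdMeasure, withDensity_apply _ hI.measurableSet,
    ← ofReal_integral_eq_lintegral_ofReal
      (integrable_of_continuous (continuous_cdDensity μ n)).integrableOn
      (Eventually.of_forall (cdDensity_nonneg μ n)), ENNReal.toReal_ofReal]
  exact integral_nonneg (cdDensity_nonneg μ n)

end

/-! ### Fejér kernel and Fejér means -/

/-- The Fejér kernel `|∑_{j=0}^n u^j|² / (n + 1)` on the unit circle. -/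
def fejer (n : ℕ) (u : Circle) : ℝ :=
  ‖∑ j ∈ Finset.range (n + 1), (u : ℂ) ^ j‖ ^ 2 / ((n : ℝ) + 1)

theorem continuous_fejer (n : ℕ) : Continuous (fejer n) := by
  unfold fejer
  fun_prop

theorem fejer_nonneg (n : ℕ) (u : Circle) : 0 ≤ fejer n u := by
  unfold fejer
  positivity

theorem fejer_inv (n : ℕ) (u : Circle) : fejer n u⁻¹ = fejer n u := by
  unfold fejer
  rw [Circle.coe_inv_eq_conj]
  simp only [← map_pow, ← map_sum, RCLike.norm_conj]

/-- The geometric sum times u - 1 is u^{n+1} - 1, of modulus at most 2. -/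
theorem fejer_le {n : ℕ} {u : Circle} {δ : ℝ} (hδ : 0 < δ) (hu : δ ≤ ‖(u : ℂ) - 1‖) :
    fejer n u ≤ 4 / δ ^ 2 * (1 / ((n : ℝ) + 1)) := by
  have h := geom_sum_mul (u : ℂ) (n + 1)
  have h1 : ‖∑ j ∈ Finset.range (n + 1), (u : ℂ) ^ j‖ * ‖(u : ℂ) - 1‖ ≤ 2 := by
    rw [← norm_mul, h]
    refine (norm_sub_le _ _).trans ?_
    rw [norm_pow, Circle.norm_coe]
    norm_num
  have h2 : ‖∑ j ∈ Finset.range (n + 1), (u : ℂ) ^ j‖ ≤ 2 / δ := by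
    rw [le_div_iff₀ hδ]
    exact (mul_le_mul_of_nonneg_left hu (norm_nonneg _)).trans h1
  have h3 : ‖∑ j ∈ Finset.range (n + 1), (u : ℂ) ^ j‖ ^ 2 ≤ 4 / δ ^ 2 := by
    refine (pow_le_pow_left₀ (norm_nonneg _) h2 2).trans_eq ?_
    rw [div_pow]; norm_num
  rw [fejer, div_eq_mul_one_div]
  gcongr

theorem exists_fejer_le (n : ℕ) : ∃ C, ∀ u, ‖fejer n u‖ ≤ C := by
  obtain ⟨C, hC⟩ := isCompact_univ.exists_bound_of_continuousOn (continuous_fejer n).continuousOn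
  exact ⟨C, fun u => hC u (Set.mem_univ u)⟩

theorem orthonormal_X_pow_arcMeasure : Orthonormal ℂ fun n : ℕ => toL2 arcMeasure (X ^ n) := by
  have hlt : ∀ i j : ℕ, i < j →
      inner ℂ (toL2 arcMeasure (X ^ i)) (toL2 arcMeasure (X ^ j)) = 0 := by
    intro i j hij
    rw [inner_toL2, polyInner, ← integral_pow_arcMeasure (k := j - i) (by omega)]
    refine integral_congr_ae (Eventually.of_forall fun z => ?_)
    have hz : conj (z : ℂ) * (z : ℂ) = 1 := by rw [Complex.conj_mul', Circle.norm_coe]; simp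
    have hn : (z : ℂ) ^ j = (z : ℂ) ^ i * (z : ℂ) ^ (j - i) := by rw [← pow_add]; congr 1; omega
    have hzi : conj ((z : ℂ) ^ i) * (z : ℂ) ^ i = 1 := by rw [map_pow, ← mul_pow, hz, one_pow]
    simp only [eval_pow, eval_X, hn]
    linear_combination ((z : ℂ) ^ (j - i)) * hzi
  constructor
  · intro n
    have h := norm_toL2_sq arcMeasure (X ^ n)
    simp only [eval_pow, eval_X, norm_pow, Circle.norm_coe, one_pow, integral_const,
      probReal_univ, smul_eq_mul, mul_one] at h
    exact (pow_eq_one_iff_of_nonneg (norm_nonneg _) two_ne_zero).1 h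
  · intro i j hij
    rcases hij.lt_or_gt with h | h
    · exact hlt i j h
    · beta_reduce
      rw [← inner_conj_symm, hlt j i h, map_zero]

/-- Parseval: ∑ c^j z^j has n + 1 coefficients of modulus one. -/
theorem integral_fejer_mul (n : ℕ) (c : Circle) : ∫ z, fejer n (z * c) ∂arcMeasure = 1 := by
  have h := norm_toL2_sq arcMeasure (∑ j ∈ Finset.range (n + 1), ((c : ℂ) ^ j) • (X : ℂ[X]) ^ j)
  have h1 : ‖toL2 arcMeasure (∑ j ∈ Finset.range (n + 1), ((c : ℂ) ^ j) • (X : ℂ[X]) ^ j)‖ ^ 2 =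
      (n : ℝ) + 1 := by
    have h2 := inner_self_eq_norm_sq_to_K (𝕜 := ℂ)
      (toL2 arcMeasure (∑ j ∈ Finset.range (n + 1), ((c : ℂ) ^ j) • (X : ℂ[X]) ^ j))
    simp only [map_sum, map_smul] at h2 ⊢
    rw [orthonormal_X_pow_arcMeasure.inner_sum] at h2
    have hc : ∀ j : ℕ, conj ((c : ℂ) ^ j) * (c : ℂ) ^ j = 1 := fun j => by
      rw [Complex.conj_mul', norm_pow, Circle.norm_coe]; simp
    simp only [hc, Finset.sum_const, Finset.card_range, nsmul_eq_mul, mul_one] at h2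
    refine Complex.ofReal_injective (Eq.trans ?_ h2.symm |>.trans ?_)
    · push_cast; rfl
    · push_cast; rfl
  rw [h1] at h
  have hn : (n : ℝ) + 1 ≠ 0 := by positivity
  simp only [fejer]
  rw [integral_div, div_eq_one_iff_eq hn, h]
  refine integral_congr_ae (Eventually.of_forall fun z => ?_)
  simp only [eval_finsetSum, eval_smul, eval_pow, eval_X, smul_eq_mul, Circle.coe_mul, mul_pow,
    mul_comm]

theorem integral_fejer_left (n : ℕ) (z : Circle) : ∫ ζ, fejer n (ζ * z⁻¹) ∂arcMeasure = 1 :=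
  integral_fejer_mul n _

theorem integral_fejer_right (n : ℕ) (ζ : Circle) : ∫ z, fejer n (ζ * z⁻¹) ∂arcMeasure = 1 := by
  rw [← integral_fejer_mul n ζ⁻¹]
  refine integral_congr_ae (Eventually.of_forall fun z => ?_)
  beta_reduce
  rw [← fejer_inv, mul_inv_rev, inv_inv]

/-- The Fejér mean of the measure `f dν`. -/
def fejerMean (n : ℕ) (ν : Measure Circle) (f : Circle → ℝ) (z : Circle) : ℝ :=
  ∫ ζ, fejer n (ζ * z⁻¹) * f ζ ∂ν

section

variable {ν : Measure Circle} {f g : Circle → ℝ}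

theorem integrable_fejer_mul (n : ℕ) (hf : Integrable f ν) (z : Circle) :
    Integrable (fun ζ => fejer n (ζ * z⁻¹) * f ζ) ν := by
  obtain ⟨C, hC⟩ := exists_fejer_le n
  refine hf.bdd_mul (c := C) ?_ (Eventually.of_forall fun ζ => hC _)
  exact ((continuous_fejer n).comp (continuous_mul_const _)).aestronglyMeasurable

theorem integrable_fejer_mul_prod [IsFiniteMeasure ν] (n : ℕ) (hf : Integrable f ν) :
    Integrable (fun p : Circle × Circle => fejer n (p.2 * p.1⁻¹) * f p.2) (arcMeasure.prod ν) := by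
  obtain ⟨C, hC⟩ := exists_fejer_le n
  refine (hf.comp_snd arcMeasure).bdd_mul (c := C) ?_ (Eventually.of_forall fun ζ => hC _)
  exact ((continuous_fejer n).comp (by fun_prop)).aestronglyMeasurable

theorem integrable_fejerMean [IsFiniteMeasure ν] (n : ℕ) (hf : Integrable f ν) :
    Integrable (fejerMean n ν f) arcMeasure :=
  (integrable_fejer_mul_prod n hf).integral_prod_left

theorem integral_fejerMean [IsFiniteMeasure ν] (n : ℕ) (hf : Integrable f ν) :
    ∫ z, fejerMean n ν f z ∂arcMeasure = ∫ ζ, f ζ ∂ν := by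
  unfold fejerMean
  rw [integral_integral_swap (integrable_fejer_mul_prod n hf)]
  refine integral_congr_ae (Eventually.of_forall fun ζ => ?_)
  beta_reduce
  rw [integral_mul_const, integral_fejer_right, one_mul]

theorem abs_fejerMean_le (n : ℕ) (z : Circle) :
    |fejerMean n ν f z| ≤ fejerMean n ν (fun ζ => |f ζ|) z := by
  refine (abs_integral_le_integral_abs).trans_eq ?_
  refine integral_congr_ae (Eventually.of_forall fun ζ => ?_)
  beta_reduce
  rw [abs_mul, abs_of_nonneg (fejer_nonneg _ _)]

theorem fejerMean_nonneg (hf : ∀ ζ, 0 ≤ f ζ) (n : ℕ) (z : Circle) : 0 ≤ fejerMean n ν f z :=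
  integral_nonneg fun ζ => mul_nonneg (fejer_nonneg _ _) (hf ζ)

theorem fejerMean_sub (n : ℕ) (hf : Integrable f ν) (hg : Integrable g ν) (z : Circle) :
    fejerMean n ν (fun ζ => f ζ - g ζ) z = fejerMean n ν f z - fejerMean n ν g z := by
  unfold fejerMean
  rw [← integral_sub (integrable_fejer_mul n hf z) (integrable_fejer_mul n hg z)]
  simp only [mul_sub]

end

theorem dist_eq_norm_mul_inv_sub_one (z ζ : Circle) :
    dist ζ z = ‖((ζ * z⁻¹ : Circle) : ℂ) - 1‖ := by
  have hz : (z : ℂ) ≠ 0 := z.coe_ne_zero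
  have h : ((ζ * z⁻¹ : Circle) : ℂ) - 1 = ((ζ : ℂ) - z) * ((z⁻¹ : Circle) : ℂ) := by
    rw [Circle.coe_mul, Circle.coe_inv]
    field_simp
  rw [h, norm_mul, Circle.norm_coe, mul_one, ← dist_eq_norm]
  rfl

/-- Fejér's theorem. -/
theorem eventually_abs_fejerMean_sub_le {g : Circle → ℝ} (hg : Continuous g) {ε : ℝ} (hε : 0 < ε) :
    ∀ᶠ n : ℕ in atTop, ∀ z, |fejerMean n arcMeasure g z - g z| ≤ ε := by
  obtain ⟨M, hM⟩ := isCompact_univ.exists_bound_of_continuousOn hg.continuousOn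
  have hM0 : 0 ≤ M := (norm_nonneg _).trans (hM 1 (Set.mem_univ _))
  obtain ⟨δ, hδ, hu⟩ := Metric.uniformContinuous_iff.1
    (CompactSpace.uniformContinuous_of_continuous hg) (ε / 2) (half_pos hε)
  have hlim : Tendsto (fun n : ℕ => 2 * M * (4 / δ ^ 2 * (1 / ((n : ℝ) + 1)))) atTop (𝓝 0) := by
    simpa using (tendsto_one_div_add_atTop_nhds_zero_nat.const_mul (4 / δ ^ 2)).const_mul (2 * M)
  filter_upwards [hlim.eventually_le_const (half_pos hε)] with n hn z
  have hgi : Integrable g arcMeasure := integrable_of_continuous hg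
  have hfi : Integrable (fun ζ => fejer n (ζ * z⁻¹)) arcMeasure :=
    integrable_of_continuous ((continuous_fejer n).comp (continuous_mul_const _))
  have h1 : fejerMean n arcMeasure g z - g z =
      ∫ ζ, fejer n (ζ * z⁻¹) * (g ζ - g z) ∂arcMeasure := by
    have h2 : fejerMean n arcMeasure (fun _ => g z) z = g z := by
      rw [fejerMean, integral_mul_const, integral_fejer_left, one_mul]
    rw [← fejerMean, fejerMean_sub n hgi (integrable_const _), h2]
  rw [h1]
  -- The first term covers ζ within δ of z, by uniform continuity; the second covers the rest, by
  -- decay of the kernel.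
  have hb : ∀ ζ, ‖fejer n (ζ * z⁻¹) * (g ζ - g z)‖ ≤
      fejer n (ζ * z⁻¹) * (ε / 2) + 2 * M * (4 / δ ^ 2 * (1 / ((n : ℝ) + 1))) := by
    intro ζ
    rw [norm_mul, Real.norm_of_nonneg (fejer_nonneg _ _), ← dist_eq_norm]
    by_cases hd : dist ζ z < δ
    · have := mul_le_mul_of_nonneg_left (hu hd).le (fejer_nonneg n (ζ * z⁻¹))
      have : 0 ≤ 2 * M * (4 / δ ^ 2 * (1 / ((n : ℝ) + 1))) := by positivity
      linarith
    · have h3 : fejer n (ζ * z⁻¹) ≤ _ :=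
        fejer_le hδ (by rw [← dist_eq_norm_mul_inv_sub_one]; exact not_lt.1 hd)
      have h4 : dist (g ζ) (g z) ≤ 2 * M := by
        rw [dist_eq_norm]
        linarith [norm_sub_le (g ζ) (g z), hM ζ (Set.mem_univ _), hM z (Set.mem_univ _)]
      have h5 := mul_le_mul h3 h4 dist_nonneg (by positivity)
      have h6 := mul_nonneg (fejer_nonneg n (ζ * z⁻¹)) (half_pos hε).le
      linarith
  rw [← Real.norm_eq_abs]
  refine (norm_integral_le_of_norm_le ((hfi.mul_const _).add (integrable_const _))
    (Eventually.of_forall hb)).trans ?_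
  rw [integral_add' (hfi.mul_const _) (integrable_const _), integral_mul_const,
    integral_fejer_left, integral_const, probReal_univ]
  simp only [smul_eq_mul]
  linarith

/-- Fejér means converge in `L¹`. -/
theorem tendsto_integral_abs_fejerMean_sub {f : Circle → ℝ} (hf : Integrable f arcMeasure) :
    Tendsto (fun n : ℕ => ∫ z, |fejerMean n arcMeasure f z - f z| ∂arcMeasure) atTop (𝓝 0) := by
  refine Metric.tendsto_atTop'.2 fun ε hε => ?_
  obtain ⟨g, hfg, hgi⟩ := hf.exists_boundedContinuous_integral_sub_le (ε := ε / 4) (by positivity)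
  obtain ⟨N, hN⟩ := eventually_atTop.1
    (eventually_abs_fejerMean_sub_le g.continuous (show 0 < ε / 4 by positivity))
  refine ⟨N, fun n hn => ?_⟩
  have hfgi : Integrable (fun z => |f z - g z|) arcMeasure := (hf.sub hgi).abs
  -- After integration each term is at most ε/4, since Fejér means of nonnegative functions preserve
  -- the integral.
  have hb : ∀ z, |fejerMean n arcMeasure f z - f z| ≤
      fejerMean n arcMeasure (fun ζ => |f ζ - g ζ|) z + ε / 4 + |f z - g z| := by
    intro z
    have h1 := hN n hn.le z
    have h2 := abs_fejerMean_le (ν := arcMeasure) (f := fun ζ => f ζ - g ζ) n z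
    rw [fejerMean_sub n hf hgi] at h2
    have h3 : fejerMean n arcMeasure f z - f z =
        (fejerMean n arcMeasure f z - fejerMean n arcMeasure g z) +
          (fejerMean n arcMeasure g z - g z) - (f z - g z) := by ring
    rw [h3]
    refine (abs_sub _ _).trans ?_
    refine add_le_add ((abs_add_le _ _).trans (add_le_add h2 h1)) le_rfl
  have hi1 := integrable_fejerMean n hfgi
  have hle := integral_mono ((integrable_fejerMean n hf).sub hf).abs
    ((hi1.add (integrable_const (ε / 4))).add hfgi) hb
  rw [integral_add' (hi1.add (integrable_const _)) hfgi, integral_add' hi1 (integrable_const _),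
    integral_fejerMean n hfgi, integral_const, probReal_univ] at hle
  simp only [smul_eq_mul, Real.norm_eq_abs] at hle hfg
  rw [Real.dist_eq, sub_zero, abs_of_nonneg (integral_nonneg fun _ => abs_nonneg _)]
  simp only [Pi.sub_apply] at hle
  linarith

/-- The Fejér means of a singular measure are small in `L¹` off a set of small measure. -/
theorem exists_setIntegral_fejerMean_le {ν : Measure Circle} [IsFiniteMeasure ν]
    (hν : ν ⟂ₘ arcMeasure) {ε : ℝ} (hε : 0 < ε) :
    ∃ U : Set Circle, MeasurableSet U ∧ arcMeasure.real U ≤ ε ∧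
      ∀ᶠ n : ℕ in atTop, ∫ z in Uᶜ, fejerMean n ν 1 z ∂arcMeasure ≤ ε := by
  obtain ⟨S, hS, hνS, hT⟩ := hν
  -- `U` is a small open neighbourhood of the null set carrying ν, and `K` a compact part of that
  -- set missing at most ε/2 of ν. Points off `U` are δ-far from `K`, so `K` contributes O(1/n)
  -- there; the rest contributes at most its mass.
  obtain ⟨U, hTU, hU, hUε⟩ := Set.exists_isOpen_lt_of_lt (μ := arcMeasure) Sᶜ (ENNReal.ofReal ε)
    (by rw [hT]; simpa using hε)
  obtain ⟨K, hKS, hK, hKε⟩ := hS.compl.exists_isCompact_lt_add (μ := ν) (measure_ne_top _ _)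
    (ε := ENNReal.ofReal (ε / 2)) (by simpa using hε)
  obtain ⟨δ, hδ, hδU⟩ := hK.exists_thickening_subset_open hU (hKS.trans hTU)
  have hKc : ν.real Kᶜ ≤ ε / 2 := by
    have h1 : ν Kᶜ ≤ ENNReal.ofReal (ε / 2) := by
      have h2 : ν Kᶜ + ν K ≤ ENNReal.ofReal (ε / 2) + ν K := by
        rw [add_comm, measure_add_measure_compl hK.measurableSet, ← measure_add_measure_compl hS,
          hνS, zero_add, add_comm]
        exact hKε.le
      exact (ENNReal.add_le_add_iff_right (measure_ne_top ν K)).1 h2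
    exact ENNReal.toReal_le_of_le_ofReal (by positivity) h1
  refine ⟨U, hU.measurableSet, ENNReal.toReal_le_of_le_ofReal hε.le hUε.le, ?_⟩
  have hlim : Tendsto (fun n : ℕ => 4 / δ ^ 2 * (1 / ((n : ℝ) + 1)) * ν.real K) atTop (𝓝 0) := by
    simpa using (tendsto_one_div_add_atTop_nhds_zero_nat.const_mul (4 / δ ^ 2)).mul_const (ν.real K)
  filter_upwards [hlim.eventually_le_const (half_pos hε)] with n hn
  have h1i : ∀ m : Measure Circle, [IsFiniteMeasure m] → Integrable (1 : Circle → ℝ) m :=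
    fun m _ => integrable_const (1 : ℝ)
  have hb : ∀ z ∈ Uᶜ, fejerMean n ν 1 z ≤ ε / 2 + fejerMean n (ν.restrict Kᶜ) 1 z := by
    intro z hz
    have hi := integrable_fejer_mul n (h1i ν) z
    rw [fejerMean, ← integral_add_compl hK.measurableSet hi]
    refine add_le_add ?_ le_rfl
    refine le_trans ?_ hn
    have h2 := setIntegral_mono_on hi.integrableOn
      (integrableOn_const (measure_ne_top ν K) (C := 4 / δ ^ 2 * (1 / ((n : ℝ) + 1))))
      hK.measurableSet fun ζ hζ => ?_
    · refine h2.trans_eq ?_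
      rw [setIntegral_const, smul_eq_mul, mul_comm]
    · rw [Pi.one_apply, mul_one]
      refine fejer_le hδ ?_
      rw [← dist_eq_norm_mul_inv_sub_one, dist_comm]
      by_contra hlt
      exact hz (hδU (Metric.mem_thickening_iff.2 ⟨ζ, hζ, not_le.1 hlt⟩))
  have hi2 := integrable_fejerMean n (h1i (ν.restrict Kᶜ))
  calc ∫ z in Uᶜ, fejerMean n ν 1 z ∂arcMeasure
      ≤ ∫ z in Uᶜ, (ε / 2 + fejerMean n (ν.restrict Kᶜ) 1 z) ∂arcMeasure :=
        setIntegral_mono_on (integrable_fejerMean n (h1i ν)).integrableOn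
          ((integrable_const _).add hi2).integrableOn hU.measurableSet.compl hb
    _ ≤ ∫ z, (ε / 2 + fejerMean n (ν.restrict Kᶜ) 1 z) ∂arcMeasure :=
        setIntegral_le_integral ((integrable_const _).add hi2) (Eventually.of_forall fun z =>
          add_nonneg (by positivity) (fejerMean_nonneg (fun _ => zero_le_one) _ _))
    _ = ε / 2 + ν.real Kᶜ := by
        rw [integral_add (integrable_const _) hi2, integral_fejerMean n (h1i _), integral_const,
          probReal_univ]
        simp
    _ ≤ ε := by linarith

/-! ### The weight and the Lebesgue decomposition -/

theorem weight_nonneg {μ : Measure Circle} (z : Circle) : 0 ≤ weight μ z := ENNReal.toReal_nonneg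

theorem measurable_weight {μ : Measure Circle} : Measurable (weight μ) :=
  (Measure.measurable_rnDeriv μ arcMeasure).ennreal_toReal

/-- Continuity from above: the sets {w < 1/(m+1)} decrease to a set that is null in `I`. -/
theorem exists_arcMeasure_weight_lt_le {μ : Measure Circle} {I : Set Circle}
    (hw : ∀ᵐ z ∂(arcMeasure.restrict I), 0 < weight μ z) {ε : ℝ} (hε : 0 < ε) :
    ∃ η > 0, (arcMeasure.restrict I).real {z | weight μ z < η} ≤ ε := by
  have hlim := tendsto_measure_iInter_atTop (μ := arcMeasure.restrict I)
    (s := fun m : ℕ => {z | weight μ z < 1 / ((m : ℝ) + 1)})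
    (fun m => (measurableSet_lt measurable_weight measurable_const).nullMeasurableSet)
    (fun a b hab z (hz : weight μ z < 1 / ((b : ℝ) + 1)) =>
      hz.trans_le (Nat.one_div_le_one_div hab))
    ⟨0, measure_ne_top _ _⟩
  have h0 : (arcMeasure.restrict I) (⋂ m : ℕ, {z | weight μ z < 1 / ((m : ℝ) + 1)}) = 0 := by
    refine measure_mono_null (fun z hz => ?_) (ae_iff.1 hw)
    simp only [Set.mem_iInter, Set.mem_ofPred_eq, not_lt] at hz ⊢
    exact ge_of_tendsto' tendsto_one_div_add_atTop_nhds_zero_nat fun m => (hz m).le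
  rw [h0] at hlim
  obtain ⟨m, hm⟩ := (hlim.eventually_lt_const (show (0 : ENNReal) < ENNReal.ofReal ε by
    simpa using hε)).exists
  exact ⟨1 / ((m : ℝ) + 1), by positivity, ENNReal.toReal_le_of_le_ofReal hε.le hm.le⟩

section

variable {μ : Measure Circle} [IsFiniteMeasure μ]

instance isFiniteMeasure_singPart : IsFiniteMeasure (singPart μ) := by
  unfold singPart
  infer_instance

theorem singPart_add_withDensity (μ : Measure Circle) [IsFiniteMeasure μ] :
    singPart μ + arcMeasure.withDensity (μ.rnDeriv arcMeasure) = μ :=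
  μ.singularPart_add_rnDeriv arcMeasure

theorem integrable_weight : Integrable (weight μ) arcMeasure := Measure.integrable_toReal_rnDeriv

theorem setIntegral_eq_singPart_add {I : Set Circle} (hI : MeasurableSet I) {f : Circle → ℝ}
    (hf : Continuous f) :
    ∫ z in I, f z ∂μ = ∫ z in I, f z ∂(singPart μ) + ∫ z in I, f z * weight μ z ∂arcMeasure := by
  conv_lhs => rw [← singPart_add_withDensity μ]
  rw [Measure.restrict_add, integral_add_measure (integrable_of_continuous hf)
    (integrable_of_continuous hf)]
  congr 1
  rw [setIntegral_withDensity_eq_setIntegral_toReal_smul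
    (Measure.measurable_rnDeriv μ arcMeasure)
    (ae_restrict_of_ae (Measure.rnDeriv_lt_top μ arcMeasure)) _ hI]
  simp only [smul_eq_mul, weight, mul_comm]

theorem integrable_mul_weight {f : Circle → ℝ} (hf : Continuous f) :
    Integrable (fun z => f z * weight μ z) arcMeasure := by
  obtain ⟨C, hC⟩ := isCompact_univ.exists_bound_of_continuousOn hf.continuousOn
  exact integrable_weight.bdd_mul (c := C) hf.aestronglyMeasurable
    (Eventually.of_forall fun z => hC z (Set.mem_univ z))

theorem fejerMean_one_eq (n : ℕ) (z : Circle) :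
    fejerMean n μ 1 z = fejerMean n (singPart μ) 1 z + fejerMean n arcMeasure (weight μ) z := by
  have h := setIntegral_eq_singPart_add (μ := μ) MeasurableSet.univ
    ((continuous_fejer n).comp (continuous_mul_const z⁻¹))
  simpa [fejerMean] using h

/-- A polynomial vanishing μ-a.e. vanishes Lebesgue-a.e. where w > 0, thus a.e. on an arc of
positive measure; a nonzero one has finitely many zeros. -/
theorem isNondegenerate_of_weight_pos {I : Set Circle} (hI : IsArc I)
    (hw : ∀ᵐ z ∂(arcMeasure.restrict I), 0 < weight μ z) : IsNondegenerate μ := by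
  intro P hP
  by_contra hP0
  have h0 := norm_toL2_sq μ P
  rw [hP, norm_zero, zero_pow two_ne_zero] at h0
  have hc : Continuous fun z : Circle => ‖P.eval (z : ℂ)‖ ^ 2 :=
    ((P.continuous.comp continuous_subtype_val).norm).pow 2
  have hae := (integral_eq_zero_iff_of_nonneg (fun z => by positivity)
    (integrable_of_continuous hc)).1 h0.symm
  have hle : arcMeasure.withDensity (μ.rnDeriv arcMeasure) ≤ μ :=
    Measure.withDensity_rnDeriv_le μ arcMeasure
  have hae2 := (ae_withDensity_iff (Measure.measurable_rnDeriv μ arcMeasure)).1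
    (hae.filter_mono (ae_mono hle))
  have hfin : ∀ᵐ z : Circle ∂arcMeasure, P.eval (z : ℂ) ≠ 0 := by
    have hs : {z : Circle | P.eval (z : ℂ) = 0}.Finite :=
      Set.Finite.preimage (f := fun z : Circle => (z : ℂ)) Circle.coe_injective.injOn
        ((Polynomial.finite_setOfPred_isRoot hP0))
    rw [ae_iff]
    simpa using hs.measure_zero arcMeasure
  have hfalse : ∀ᵐ z ∂(arcMeasure.restrict I), False := by
    filter_upwards [hw, ae_restrict_of_ae hae2, ae_restrict_of_ae hfin] with z h1 h2 h3
    have h4 : μ.rnDeriv arcMeasure z ≠ 0 := by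
      intro h
      simp [weight, h] at h1
    exact h3 (by simpa using h2 h4)
  rw [eventually_false_iff_eq_bot, ae_eq_bot, Measure.restrict_eq_zero] at hfalse
  exact hI.arcMeasure_ne_zero hfalse

/-! ### The lower bound for the kernel -/

theorem IsNondegenerate.one_le_cdDensity_mul_fejerMean (hμ : IsNondegenerate μ) (n : ℕ)
    (z : Circle) : 1 ≤ cdDensity μ n z * fejerMean n μ 1 z := by
  have hn : (0 : ℝ) < (n : ℝ) + 1 := by positivity
  -- Trial polynomial peaked at z: P(z) = n + 1, and |P|²/(n + 1) is the Fejér kernel centred at z.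
  set P : ℂ[X] := ∑ j ∈ Finset.range (n + 1), (((z⁻¹ : Circle) : ℂ) ^ j) • (X : ℂ[X]) ^ j with hP
  have hev : ∀ ζ : Circle, P.eval (ζ : ℂ) =
      ∑ j ∈ Finset.range (n + 1), ((ζ * z⁻¹ : Circle) : ℂ) ^ j := by
    intro ζ
    simp only [hP, eval_finsetSum, eval_smul, eval_pow, eval_X, smul_eq_mul, Circle.coe_mul,
      mul_pow, mul_comm]
  have hdeg : P.degree < ((n + 1 : ℕ) : WithBot ℕ) := by
    refine (degree_sum_le _ _).trans_lt ?_
    refine (Finset.sup_lt_iff (WithBot.bot_lt_coe (n + 1))).2 fun j hj => ?_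
    refine (degree_smul_le _ _).trans_lt ?_
    rw [degree_X_pow]
    exact Nat.cast_lt.2 (Finset.mem_range.1 hj)
  have h := hμ.norm_eval_sq_le hdeg (z : ℂ)
  have h1 : P.eval (z : ℂ) = (n : ℂ) + 1 := by rw [hev]; simp
  have hnn : ‖(n : ℂ) + 1‖ = (n : ℝ) + 1 := by exact_mod_cast Complex.norm_natCast (n + 1)
  have h2 : ‖toL2 μ P‖ ^ 2 = ((n : ℝ) + 1) * fejerMean n μ 1 z := by
    rw [norm_toL2_sq, fejerMean, ← integral_const_mul]
    refine integral_congr_ae (Eventually.of_forall fun ζ => ?_)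
    simp only [hev, fejer, Pi.one_apply, mul_one]
    field_simp
  rw [h1, hnn, h2] at h
  rw [cdDensity]
  rw [div_mul_eq_mul_div, one_le_div hn]
  nlinarith

/-- Here g plays the Fejér mean of μ. If g ≤ w then wk ≥ kg ≥ 1; otherwise 1 - wk ≤ (g - w)/g, and g
≥ w ≥ η. -/
theorem one_sub_le_of_one_le_mul {w k g η x : ℝ} (hη : 0 < η) (hw : η ≤ w) (hk : 0 ≤ k)
    (hkg : 1 ≤ k * g) (hx : g - w ≤ x) (hx0 : 0 ≤ x) : max (1 - w * k) 0 ≤ x / η := by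
  refine max_le ?_ (by positivity)
  rcases le_total g w with h | h
  · have : k * g ≤ w * k := by nlinarith
    have : 0 ≤ x / η := by positivity
    linarith
  · have hg : 0 < g := by linarith
    have h1 : 1 / g ≤ k := by rwa [div_le_iff₀ hg]
    have h2 : w * (1 / g) ≤ w * k := by gcongr; linarith
    have h3 : 1 - w * (1 / g) = (g - w) / g := by field_simp
    have h4 : (g - w) / g ≤ x / η := div_le_div₀ hx0 hx hη (by linarith)
    linarith

/-- The Máté–Nevai bound: where `w > 0`, `w(z) K_n(z, z) / (n + 1)` is asymptotically at least
one, in the sense of `L¹`. -/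
theorem IsNondegenerate.tendsto_setIntegral_max_one_sub (hμ : IsNondegenerate μ) {I : Set Circle}
    (hw : ∀ᵐ z ∂(arcMeasure.restrict I), 0 < weight μ z) :
    Tendsto (fun n : ℕ => ∫ z in I, max (1 - weight μ z * cdDensity μ n z) 0 ∂arcMeasure)
      atTop (𝓝 0) := by
  refine Metric.tendsto_nhds.2 fun ε hε => ?_
  -- Budget: ε/5 each for {w < η} and `U`, where the integrand is bounded by 1, and ε/5 for each of
  -- the two Fejér errors. These errors get divided by η, hence the thresholds ε/5 · η.
  obtain ⟨η, hη, hWη⟩ := exists_arcMeasure_weight_lt_le hw (show 0 < ε / 5 by positivity)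
  obtain ⟨U, hU, hUε, hev⟩ := exists_setIntegral_fejerMean_le (ν := singPart μ)
    (Measure.mutuallySingular_singularPart μ arcMeasure)
    (show 0 < min (ε / 5) (ε / 5 * η) by positivity)
  have hL1 := tendsto_integral_abs_fejerMean_sub (integrable_weight (μ := μ))
  filter_upwards [hev, hL1.eventually_le_const (show 0 < ε / 5 * η by positivity)] with n h1 h2
  set W : Set Circle := {z | weight μ z < η} with hW
  have hWm : MeasurableSet W := measurableSet_lt measurable_weight measurable_const
  set A : Circle → ℝ := fun z => |fejerMean n arcMeasure (weight μ) z - weight μ z| with hA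
  set B : Circle → ℝ := Uᶜ.indicator (fejerMean n (singPart μ) 1) with hB
  have hAi : Integrable A arcMeasure :=
    ((integrable_fejerMean n integrable_weight).sub integrable_weight).abs
  have hBi : Integrable B arcMeasure :=
    (integrable_fejerMean n (integrable_const (1 : ℝ))).indicator hU.compl
  have hB0 : ∀ z, 0 ≤ B z := fun z =>
    Set.indicator_nonneg (fun z _ => fejerMean_nonneg (fun _ => zero_le_one) n z) z
  have hA0 : ∀ z, 0 ≤ A z := fun z => abs_nonneg _
  have hW0 : ∀ z, 0 ≤ W.indicator (1 : Circle → ℝ) z := fun z =>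
    Set.indicator_nonneg (fun _ _ => zero_le_one) z
  have hU0 : ∀ z, 0 ≤ U.indicator (1 : Circle → ℝ) z := fun z =>
    Set.indicator_nonneg (fun _ _ => zero_le_one) z
  have hle1 : ∀ z, max (1 - weight μ z * cdDensity μ n z) 0 ≤ 1 := fun z =>
    max_le (by linarith [mul_nonneg (weight_nonneg (μ := μ) z) (cdDensity_nonneg μ n z)])
      zero_le_one
  have hb : ∀ z, max (1 - weight μ z * cdDensity μ n z) 0 ≤
      W.indicator 1 z + U.indicator 1 z + (A z + B z) / η := by
    intro z
    have hAB : 0 ≤ (A z + B z) / η := div_nonneg (add_nonneg (hA0 z) (hB0 z)) hη.le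
    by_cases hzW : z ∈ W
    · rw [Set.indicator_of_mem hzW, Pi.one_apply]
      linarith [hle1 z, hU0 z]
    by_cases hzU : z ∈ U
    · rw [Set.indicator_of_mem hzU, Pi.one_apply]
      linarith [hle1 z, hW0 z]
    rw [Set.indicator_of_notMem hzW, Set.indicator_of_notMem hzU, zero_add, zero_add]
    refine one_sub_le_of_one_le_mul hη (not_lt.1 hzW) (cdDensity_nonneg μ n z)
      (hμ.one_le_cdDensity_mul_fejerMean n z) ?_ (add_nonneg (hA0 z) (hB0 z))
    have hBz : B z = fejerMean n (singPart μ) 1 z := Set.indicator_of_mem (by exact hzU) _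
    rw [fejerMean_one_eq, hBz]
    have := le_abs_self (fejerMean n arcMeasure (weight μ) z - weight μ z)
    simp only [hA]
    linarith
  have hWi : Integrable (W.indicator (1 : Circle → ℝ)) (arcMeasure.restrict I) :=
    (integrable_const (1 : ℝ)).indicator hWm
  have hUi : Integrable (U.indicator (1 : Circle → ℝ)) (arcMeasure.restrict I) :=
    (integrable_const (1 : ℝ)).indicator hU
  have hABi : Integrable (fun z => (A z + B z) / η) arcMeasure := (hAi.add hBi).div_const η
  have hmi : Integrable (fun z => max (1 - weight μ z * cdDensity μ n z) 0)
      (arcMeasure.restrict I) := by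
    refine Integrable.mono' (integrable_const (1 : ℝ)) ?_ (Eventually.of_forall fun z => ?_)
    · exact ((measurable_const.sub (measurable_weight.mul
        (continuous_cdDensity μ n).measurable)).max measurable_const).aestronglyMeasurable
    · rw [Real.norm_of_nonneg (le_max_right _ _)]
      exact hle1 z
  have hint := integral_mono hmi ((hWi.add hUi).add hABi.integrableOn) hb
  rw [integral_add' (hWi.add hUi) hABi.integrableOn, integral_add' hWi hUi,
    integral_indicator_one hWm, integral_indicator_one hU] at hint
  have hU' : (arcMeasure.restrict I).real U ≤ ε / 5 := by
    refine le_trans ?_ (hUε.trans (min_le_left _ _))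
    exact ENNReal.toReal_mono (measure_ne_top _ _) (Measure.restrict_le_self _)
  have hAB' : ∫ z in I, (A z + B z) / η ∂arcMeasure ≤ 2 * (ε / 5) := by
    refine (setIntegral_le_integral hABi (Eventually.of_forall fun z =>
      div_nonneg (add_nonneg (hA0 z) (hB0 z)) hη.le)).trans ?_
    rw [integral_div, integral_add hAi hBi, div_le_iff₀ hη, hB, integral_indicator hU.compl]
    linarith [h1.trans (min_le_right _ _)]
  rw [Real.dist_eq, sub_zero, abs_of_nonneg (integral_nonneg fun z => le_max_right _ _)]
  linarith

/-! ### Combining both facts -/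

theorem integral_singPart_add_integral_abs (μ : Measure Circle) [IsFiniteMeasure μ]
    {I : Set Circle} (hI : MeasurableSet I) (n : ℕ) :
    ∫ z in I, cdDensity μ n z ∂(singPart μ) +
        ∫ z in I, |1 - weight μ z * cdDensity μ n z| ∂arcMeasure =
      ∫ z in I, cdDensity μ n z ∂μ - arcMeasure.real I +
        2 * ∫ z in I, max (1 - weight μ z * cdDensity μ n z) 0 ∂arcMeasure := by
  have hki : Integrable (fun z => cdDensity μ n z * weight μ z) (arcMeasure.restrict I) :=
    (integrable_mul_weight (continuous_cdDensity μ n)).integrableOn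
  have hki' : Integrable (fun z => 1 - cdDensity μ n z * weight μ z) (arcMeasure.restrict I) :=
    (integrable_const (1 : ℝ)).sub hki
  have hi : Integrable (fun z => 1 - weight μ z * cdDensity μ n z) (arcMeasure.restrict I) := by
    simpa only [mul_comm (weight μ _)] using hki'
  have hmi : Integrable (fun z => max (1 - weight μ z * cdDensity μ n z) 0)
      (arcMeasure.restrict I) := hi.pos_part
  -- |x| = 2x_+ - x trades the absolute value for the one-sided bound plus a linear term, which the
  -- decomposition of μ merges with the singular integral.
  have habs : ∀ z, |1 - weight μ z * cdDensity μ n z| =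
      2 * max (1 - weight μ z * cdDensity μ n z) 0 - (1 - cdDensity μ n z * weight μ z) := by
    intro z
    rw [mul_comm (cdDensity μ n z)]
    rcases le_total 0 (1 - weight μ z * cdDensity μ n z) with h | h
    · rw [abs_of_nonneg h, max_eq_left h]; ring
    · rw [abs_of_nonpos h, max_eq_right h]; ring
  simp only [habs]
  rw [integral_sub (hmi.const_mul 2) hki', integral_const_mul,
    integral_sub (integrable_const _) hki, setIntegral_const,
    setIntegral_eq_singPart_add (μ := μ) hI (continuous_cdDensity μ n)]
  simp only [smul_eq_mul, mul_one]
  ring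

end

end OPUC

end

theorem theorem1p4 (μ : Measure Circle) [IsFiniteMeasure μ] (hreg : OPUC.IsRegularCircle μ)
    (I : Set Circle) (hI : OPUC.IsArc I)
    (hw : ∀ᵐ z ∂(OPUC.arcMeasure.restrict I), 0 < OPUC.weight μ z) :
    Tendsto (fun n : ℕ =>
        ∫ z in I, 1 / ((n : ℂ) + 1) * OPUC.cdKernel μ n z z ∂(OPUC.singPart μ))
      atTop (𝓝 0) ∧
    Tendsto (fun n : ℕ =>
        ∫ z in I, ‖1 - (OPUC.weight μ z : ℂ) * (1 / ((n : ℂ) + 1)) * OPUC.cdKernel μ n z z‖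
          ∂OPUC.arcMeasure)
      atTop (𝓝 0) := by
  open OPUC in
  have hμ : IsNondegenerate μ := isNondegenerate_of_weight_pos hI hw
  have hnorm : ∀ (n : ℕ) (z : Circle),
      ‖1 - (weight μ z : ℂ) * (1 / ((n : ℂ) + 1)) * cdKernel μ n z z‖ =
        |1 - weight μ z * cdDensity μ n z| := by
    intro n z
    rw [mul_assoc, cdKernel_self, ← Complex.ofReal_mul, ← Complex.ofReal_one,
      ← Complex.ofReal_sub, Complex.norm_real, Real.norm_eq_abs]
  simp only [cdKernel_self, hnorm, integral_complex_ofReal]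
  have hlim : Tendsto (fun n => ∫ z in I, cdDensity μ n z ∂(singPart μ) +
      ∫ z in I, |1 - weight μ z * cdDensity μ n z| ∂arcMeasure) atTop (𝓝 0) := by
    simp only [integral_singPart_add_integral_abs μ hI.measurableSet]
    simpa using ((hμ.tendsto_setIntegral_cdDensity hreg hI).sub_const (arcMeasure.real I)).add
      ((hμ.tendsto_setIntegral_max_one_sub hw).const_mul 2)
  have h1 : ∀ n, 0 ≤ ∫ z in I, cdDensity μ n z ∂(singPart μ) := fun n =>
    integral_nonneg (cdDensity_nonneg μ n)
  have h2 : ∀ n, 0 ≤ ∫ z in I, |1 - weight μ z * cdDensity μ n z| ∂arcMeasure := fun n =>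
    integral_nonneg fun _ => abs_nonneg _
  constructor
  · rw [← Complex.ofReal_zero]
    exact (Complex.continuous_ofReal.tendsto 0).comp
      (squeeze_zero h1 (fun n => le_add_of_nonneg_right (h2 n)) hlim)
  · exact squeeze_zero h2 (fun n => le_add_of_nonneg_left (h1 n)) hlim
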